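/- Let $X\subseteq\{x\in\mathbb R^d:\|x\|_2\le 1\}$ be compact and $Y=\{-1,+1\}$. Let $\mathcal H$ be a class of classifiers $h:X\to Y$ that are all $R$-Lipschitz ($|h(x)-h(x')|\le R\|x-x'\|_2$, $R\ge 0$), and let $\ell:Y\times Y\to\mathbb R$ be a loss with $|\ell|\le B$ that is $L$-Lipschitz in each of its two arguments ($L\ge 0$). For a probability distribution $D$ on $X\times Y$ and a data set $S=(x_i,y_i)_{i=1}^n$ put $\epsilon_D(h)=\mathbb E_{(x,y)\sim D}[\ell(h(x),y)]$ and $\hat\epsilon_S(h)=\frac1n\sum_{i=1}^n\ell(h(x_i),y_i)$. For $1\le p\le 2$ and $r\ge 1$ let $$W(D,D')=\inf_{\pi}\Big(\int\|z-z'\|_p^{\,r}\,d\pi(z,z')\Big)^{1/r},$$ the infimum being over all couplings $\pi$ of $D$ and $D'$, with $X\times Y\subseteq\mathbb R^{d+1}$. (For $r=1$ this is $W_p(D,D')=\inf_\pi\int\|z-z'\|_p\,d\pi$; for $p=2$ it is the usual Wasserstein distance of order $r$.) Let $D_1,\dots,D_\kappa$ ($\kappa\ge1$) be the distributions of the source domains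 in the order in which they are visited (for example along any path in the domain graph), and let $D_T$ be the target distribution. For each $t$ let $S_t$ be a data set of $n_t\ge1$ independent draws from $D_t$, and let $\hat h_t\in\mathcal H$ be any minimiser of $\hat\epsilon_t:=\hat\epsilon_{S_t}$ over $\mathcal H$. Put $N=\sum_{t=1}^\kappa n_t$ and assume $N\ge 2$. Assume that for every $t\le\kappa$ the Rademacher complexity satisfies $$\mathcal R_{n_t}(\mathcal H)=\mathbb E_{x_1,\dots,x_{n_t}\sim D_t}\,\mathbb E_\sigma\sup_{h\in\mathcal H}\frac1{n_t}\sum_{i=1}^{n_t}\sigma_ih(x_i)\le\frac{B}{\sqrt{n_t}}.$$ Let $$\mathcal R^{\mathrm{seq}}_\kappa(\mathcal H)=\sup_{z}\mathbb E_\sigma\sup_{h\in\mathcal H}\frac1N\sum_{s=1}^N\sigma_s\,\ell_h\big(z_s(\sigma_1,\dots,\sigma_{s-1})\big),\qquad \ell_h(x,y)=\ell(h(x),y),$$ be the sequential Rademacher complexity of $\mathcal H$ with the loss $\ell$ at depth $N$; here $z$ ranges over all complete binary trees of depth $N$ with values in $X\times Y$, and $\sigma$ is uniform on $\{-1,+1\}^N$.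 Then for every $\delta\in(0,1)$, with probability at least $1-\delta$, $$\begin{aligned}\epsilon_{D_T}(\hat h_\kappa)\le{}&L\sqrt{R^2+1}\,W(D_T,D_\kappa)+\hat\epsilon_1(\hat h_1)+\Big(1+\frac1\kappa\Big)L\sqrt{R^2+1}\sum_{t=1}^{\kappa-1}W(D_t,D_{t+1})\\&+\frac{\big(4\sqrt2LB+2\sqrt2B\sqrt{\log(1/\delta)}\big)(\kappa-1)}{\kappa}\sum_{t=0}^{\kappa-1}\frac1{\sqrt{n_{t+1}}}+6B\sqrt{4\pi\log N}\;\mathcal R^{\mathrm{seq}}_\kappa(\mathcal H)\\&+\frac{B\sqrt{8\log(1/\delta)}+1}{\kappa}\sqrt{\sum_{t=1}^\kappa\frac1{n_t}}.\end{aligned}$$ -/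

import Mathlib

open MeasureTheory ProbabilityTheory

noncomputable section

namespace GFT

/-- The label space `{-1, +1}`. -/
abbrev Label : Type := ↥({-1, 1} : Set ℝ)

/-- The sample space `X × {-1, +1}` over a feature space `X ⊆ ℝ^d`. -/
abbrev Sample {d : ℕ} (X : Set (EuclideanSpace ℝ (Fin d))) : Type := ↥X × Label

/-- `ε_D(h) = E_{(x, y) ~ D} [ℓ(h(x), y)]`. -/
def risk {𝒳 : Type*} [MeasurableSpace 𝒳] (ℓ : Label → Label → ℝ)
    (D : Measure (𝒳 × Label)) (h : 𝒳 → Label) : ℝ :=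
  ∫ z, ℓ (h z.1) z.2 ∂D

/-- `(1/n) ∑ i, ℓ(h(x_i), y_i)` for a data set `S = (x_i, y_i)_{i < n}`. -/
def empRisk {𝒳 : Type*} (ℓ : Label → Label → ℝ) {n : ℕ}
    (S : Fin n → 𝒳 × Label) (h : 𝒳 → Label) : ℝ :=
  (1 / (n : ℝ)) * ∑ i, ℓ (h (S i).1) (S i).2

/-- `h` is an empirical risk minimiser over the class `H` on the data set `S`. -/
def IsERM {𝒳 : Type*} (ℓ : Label → Label → ℝ) (H : Set (𝒳 → Label)) {n : ℕ}
    (S : Fin n → 𝒳 × Label) (h : 𝒳 → Label) : Prop :=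
  h ∈ H ∧ ∀ g ∈ H, empRisk ℓ S h ≤ empRisk ℓ S g

/-- `‖z₁ - z₂‖_p` for samples `z = (x, y)`, seen as vectors of `ℝ^{d+1}`. -/
def sampleDist {d : ℕ} {X : Set (EuclideanSpace ℝ (Fin d))} (p : ℝ) (z₁ z₂ : Sample X) : ℝ :=
  ((∑ i, |z₁.1.1 i - z₂.1.1 i| ^ p) + |(z₁.2 : ℝ) - (z₂.2 : ℝ)| ^ p) ^ (1 / p)

/-- `π` is a coupling of `μ` and `ν`: its two marginals are `μ` and `ν`. -/
def IsCoupling {α : Type*} [MeasurableSpace α] (μ ν : Measure α) (π : Measure (α × α)) : Prop :=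
  π.map Prod.fst = μ ∧ π.map Prod.snd = ν

/-- The Wasserstein distance of order `r` for the `p`-norm,
`inf_π (∫ ‖z₁ - z₂‖_p ^ r dπ) ^ (1/r)`. For `r = 1` it is `inf_π ∫ ‖z₁ - z₂‖_p dπ`;
for `p = 2` it is the usual Wasserstein distance of order `r` of the Euclidean metric. -/
def wassersteinDist {d : ℕ} {X : Set (EuclideanSpace ℝ (Fin d))} (p r : ℝ)
    (μ ν : Measure (Sample X)) : ℝ :=
  sInf {c : ℝ | ∃ π : Measure (Sample X × Sample X),
    IsCoupling μ ν π ∧ c = (∫ w, sampleDist p w.1 w.2 ^ r ∂π) ^ (1 / r)}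

/-- The real number `±1` given by a sign. -/
def signVal (s : ℤˣ) : ℝ := ((s : ℤ) : ℝ)

/-- The empirical Rademacher complexity
`E_σ [sup_{f ∈ F} (1/n) ∑ i, σ_i f(x_i)]` at the points `x_1, …, x_n`. -/
def empRademacher {𝒵 : Type*} {n : ℕ} (F : Set (𝒵 → ℝ)) (x : Fin n → 𝒵) : ℝ :=
  (1 / 2 ^ n) * ∑ σ : Fin n → ℤˣ, ⨆ f : F, (1 / (n : ℝ)) * ∑ i, signVal (σ i) * f.1 (x i)

/-- The Rademacher complexity of `F` for `n` independent points with law `μ`. -/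
def rademacher {𝒵 : Type*} [MeasurableSpace 𝒵] (n : ℕ) (μ : Measure 𝒵) [SigmaFinite μ]
    (F : Set (𝒵 → ℝ)) : ℝ :=
  ∫ x : Fin n → 𝒵, empRademacher F x ∂(Measure.pi fun _ => μ)

/-- The sequential Rademacher complexity of `F` at depth `N`:
the supremum, over all `𝒵`-valued complete binary trees `z` of depth `N`, of
`E_σ [sup_{f ∈ F} (1/N) ∑ t, σ_t f(z_t(σ_1, …, σ_{t-1}))]`. -/
def seqRademacher {𝒵 : Type*} (N : ℕ) (F : Set (𝒵 → ℝ)) : ℝ :=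
  ⨆ z : (t : Fin N) → (Fin t → ℤˣ) → 𝒵,
    (1 / 2 ^ N) * ∑ σ : Fin N → ℤˣ, ⨆ f : F,
      (1 / (N : ℝ)) * ∑ t : Fin N,
        signVal (σ t) * f.1 (z t fun s => σ (Fin.castLE t.isLt.le s))

/-- The hypotheses seen as real-valued functions on the feature space. -/
def realClass {𝒳 : Type*} (H : Set (𝒳 → Label)) : Set (𝒳 → ℝ) :=
  (fun h x => (h x : ℝ)) '' H

/-- The loss class `{(x, y) ↦ ℓ(h(x), y) : h ∈ H}`. -/
def lossClass {𝒳 : Type*} (ℓ : Label → Label → ℝ) (H : Set (𝒳 → Label)) :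
    Set (𝒳 × Label → ℝ) :=
  (fun h z => ℓ (h z.1) z.2) '' H

end GFT

end

/-!
The class `H` is finite: an `R`-Lipschitz function with values in `{-1, 1}` is constant on balls of
radius less than `2 / R`, and `X` is compact. So every supremum over `H` is a maximum of measurable
functions, and the argument runs through the largest amounts
`A t = max_{h ∈ H} (ε_{D t}(h) - ε̂_t(h))`, which are functions of the samples alone; the
classifiers `h_hat t` need not depend measurably on the sample.

*Mean of `A t`.* By symmetrisation (`integral_supDeviation_le`) it is at most twice the Rademacher
complexity of the loss class. A loss on `{-1, 1}` is affine in the prediction with slope at most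
`min L B` (`exists_loss_eq_affine`), so contraction (`rademacher_lossClass_le`) and the assumption
on the classifiers bound that complexity by `min L B * B / √(n t)`.

*Fluctuation of `A t`.* By McDiarmid's inequality in its moment generating function form
(`hasSubgaussianMGF_of_bounded_differences`), `A t` minus its mean is sub-Gaussian with variance
proxy `B ^ 2 / n t`.

*Change of domain.* The loss of a member of `H` is `L √(R ^ 2 + 1)`-Lipschitz for the Euclidean
norm, hence for every `p`-norm with `p ≤ 2`, and Jensen's inequality passes from order `1` to order
`r` (`abs_integral_sub_integral_le_wassersteinDist`).

For `κ ≥ 2` let `g` minimise the true risk of the last domain. Then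
`ε_κ(h_hat κ) ≤ A κ + ε̂_κ(h_hat κ) ≤ A κ + ε̂_κ(g)`, while `ε_κ(g) ≤ ε_κ(h_hat 1)`, which the path
of Wasserstein steps and `A 1` compare to `ε̂_1(h_hat 1)`. The random error is `A 1` plus
`A κ + ε̂_κ(g)`, up to centring; its two parts are sub-Gaussian of norms `B / √(n 1)` and
`2 B / √(n κ)`, and these norms add without any independence between the data sets
(`exists_risk_erm_le_empRisk_add`). The factor `(κ - 1) / κ` together with the last term of the
bound matches the coefficient `2` exactly (`deviation_le_of_two_le`).

For `κ = 1` the factor `κ - 1` vanishes, and twice the Rademacher complexity is paid for by the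
summand `1 / √(n 1)` if `2 B ^ 2 ≤ 1`, and otherwise by the sequential Rademacher complexity, which
dominates the ordinary one through constant trees (`two_mul_rademacher_le`).
-/

namespace GFT

/-! ### Bounded differences -/

/-- Hoeffding's lemma for a function whose oscillation is at most `c`. -/
lemma integral_exp_sub_integral_le_of_forall_abs_sub_le {𝒵 : Type*} [MeasurableSpace 𝒵]
    (μ : Measure 𝒵) [IsProbabilityMeasure μ] {c : ℝ} {g : 𝒵 → ℝ} (hg : Measurable g)
    (hc : ∀ a b, |g a - g b| ≤ c) (t : ℝ) :
    ∫ a, Real.exp (t * (g a - ∫ b, g b ∂μ)) ∂μ ≤ Real.exp ((c / 2) ^ 2 * t ^ 2 / 2) := by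
  have hne : Nonempty 𝒵 := nonempty_of_isProbabilityMeasure μ
  let a₀ : 𝒵 := Classical.arbitrary 𝒵
  have hbelow : BddBelow (Set.range g) := ⟨g a₀ - c, by
    rintro _ ⟨a, rfl⟩; linarith [(abs_le.1 (hc a₀ a)).2]⟩
  have hinf : ∀ a, g a ≤ (⨅ b, g b) + c := fun a => by
    have : g a - c ≤ ⨅ b, g b := le_ciInf fun b => by linarith [(abs_le.1 (hc a b)).2]
    linarith
  have hH := hasSubgaussianMGF_of_mem_Icc (μ := μ) (X := g) (a := ⨅ b, g b)
    (b := (⨅ b, g b) + c) hg.aemeasurable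
    (Filter.Eventually.of_forall fun a => ⟨ciInf_le hbelow a, hinf a⟩)
  refine (hH.mgf_le t).trans_eq ?_
  congr 3
  simp [div_pow]

/-- **McDiarmid's inequality**, in its moment generating function form: a bounded function of `n`
independent variables that moves by at most `c` when one variable changes is sub-Gaussian with
variance proxy `n (c / 2) ^ 2`. -/
theorem integral_exp_sub_integral_le_of_bounded_differences {𝒵 : Type*} [MeasurableSpace 𝒵]
    (μ : Measure 𝒵) [IsProbabilityMeasure μ] {c M : ℝ} (t : ℝ) {n : ℕ} {f : (Fin n → 𝒵) → ℝ}
    (hf : Measurable f) (hM : ∀ z, |f z| ≤ M)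
    (hc : ∀ z i a, |f (Function.update z i a) - f z| ≤ c) :
    ∫ z, Real.exp (t * (f z - ∫ w, f w ∂Measure.pi fun _ => μ)) ∂(Measure.pi fun _ => μ)
      ≤ Real.exp (n * (c / 2) ^ 2 * t ^ 2 / 2) := by
  induction n with
  | zero =>
    have h : f = fun _ => f default := funext fun z => by rw [Subsingleton.elim z default]
    rw [h]
    simp
  | succ n ih =>
    have hcons : Measurable fun q : 𝒵 × (Fin n → 𝒵) => (Fin.cons q.1 q.2 : Fin (n + 1) → 𝒵) := by
      refine measurable_pi_lambda _ fun i => ?_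
      refine Fin.cases ?_ (fun j => ?_) i
      · simpa using measurable_fst
      · simpa [Function.comp_def] using (measurable_pi_apply j).comp measurable_snd
    have hpi : ∀ F : (Fin (n + 1) → 𝒵) → ℝ, Measurable F →
        ∫ z, F z ∂(Measure.pi fun _ => μ)
          = ∫ q, F (Fin.cons q.1 q.2) ∂(μ.prod (Measure.pi fun _ : Fin n => μ)) := by
      intro F _
      rw [← ((measurePreserving_piFinSuccAbove (fun _ : Fin (n + 1) => μ) 0).symm).integral_comp'
        (g := F)]
      simp [MeasurableEquiv.piFinSuccAbove_symm_apply, Fin.insertNthEquiv]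
    set ν : Measure (Fin n → 𝒵) := Measure.pi fun _ => μ with hν
    set f' : 𝒵 × (Fin n → 𝒵) → ℝ := fun q => f (Fin.cons q.1 q.2) with hf'
    have hf'm : Measurable f' := hf.comp hcons
    have hM' : ∀ q, |f' q| ≤ M := fun q => hM _
    have hint : Integrable f' (μ.prod ν) :=
      Integrable.of_bound hf'm.aestronglyMeasurable M (Filter.Eventually.of_forall hM')
    have hslice : ∀ a, Integrable (fun w => f' (a, w)) ν := fun a =>
      Integrable.of_bound (hf'm.comp measurable_prodMk_left).aestronglyMeasurable M
        (Filter.Eventually.of_forall fun w => hM' _)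
    set g : 𝒵 → ℝ := fun a => ∫ w, f' (a, w) ∂ν with hg
    have hgm : Measurable g := hf'm.stronglyMeasurable.integral_prod_right'.measurable
    have hgb : ∀ a, |g a| ≤ M := fun a => by
      simpa using norm_integral_le_of_norm_le_const (μ := ν) (f := fun w => f' (a, w))
        (Filter.Eventually.of_forall fun w => hM' _)
    have hgosc : ∀ a b, |g a - g b| ≤ c := fun a b => by
      rw [hg]
      simp only
      rw [← integral_sub (hslice a) (hslice b)]
      have := norm_integral_le_of_norm_le_const (μ := ν) (f := fun w => f' (a, w) - f' (b, w))
        (C := c) (Filter.Eventually.of_forall fun w => by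
          have := hc (Fin.cons b w) 0 a
          rwa [Fin.update_cons_zero] at this)
      simpa using this
    have hbound : ∀ q : 𝒵 × (Fin n → 𝒵), ∀ K : ℝ, |K| ≤ M →
        ‖Real.exp (t * (f' q - K))‖ ≤ Real.exp (|t| * (2 * M)) := fun q K hK => by
      rw [Real.norm_eq_abs, Real.abs_exp, Real.exp_le_exp]
      refine (le_abs_self _).trans ?_
      rw [abs_mul]
      gcongr
      exact (abs_sub _ _).trans (by linarith [hM' q])
    rw [hpi f hf, hpi _ (by fun_prop)]
    change ∫ q, Real.exp (t * (f' q - ∫ q, f' q ∂μ.prod ν)) ∂μ.prod ν ≤ _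
    have hEf : ∫ q, f' q ∂μ.prod ν = ∫ a, g a ∂μ := integral_prod _ hint
    have hEg : |∫ a, g a ∂μ| ≤ M := by
      simpa using norm_integral_le_of_norm_le_const (μ := μ) (f := g)
        (Filter.Eventually.of_forall fun w => hgb _)
    rw [hEf, integral_prod _ (Integrable.of_bound (by fun_prop) _
      (Filter.Eventually.of_forall fun q => hbound q _ hEg))]
    have hinner : ∀ a, ∫ w, Real.exp (t * (f' (a, w) - ∫ a, g a ∂μ)) ∂ν
        ≤ Real.exp (n * (c / 2) ^ 2 * t ^ 2 / 2) * Real.exp (t * (g a - ∫ a, g a ∂μ)) := by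
      intro a
      have h1 : ∀ w, Real.exp (t * (f' (a, w) - ∫ a, g a ∂μ))
          = Real.exp (t * (f' (a, w) - g a)) * Real.exp (t * (g a - ∫ a, g a ∂μ)) := fun w => by
        rw [← Real.exp_add]; congr 1; ring
      simp_rw [h1]
      rw [integral_mul_const]
      gcongr
      refine ih (f := fun w => f' (a, w)) (hf'm.comp measurable_prodMk_left) (fun w => hM' _) ?_
      intro w i b
      have := hc (Fin.cons a w) i.succ b
      rwa [← Fin.cons_update] at this
    have hgexp : Integrable (fun a => Real.exp (t * (g a - ∫ a, g a ∂μ))) μ :=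
      Integrable.of_bound (by fun_prop) (Real.exp (|t| * (2 * M)))
        (Filter.Eventually.of_forall fun a => by
          rw [Real.norm_eq_abs, Real.abs_exp, Real.exp_le_exp]
          refine (le_abs_self _).trans ?_
          rw [abs_mul]
          gcongr
          exact (abs_sub _ _).trans (by linarith [hgb a]))
    calc ∫ a, ∫ w, Real.exp (t * (f' (a, w) - ∫ a, g a ∂μ)) ∂ν ∂μ
        ≤ ∫ a, Real.exp (n * (c / 2) ^ 2 * t ^ 2 / 2)
            * Real.exp (t * (g a - ∫ a, g a ∂μ)) ∂μ :=
          integral_mono_of_nonneg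
            (Filter.Eventually.of_forall fun a => integral_nonneg fun w => (Real.exp_pos _).le)
            (hgexp.const_mul _) (Filter.Eventually.of_forall hinner)
      _ ≤ Real.exp (n * (c / 2) ^ 2 * t ^ 2 / 2) * Real.exp ((c / 2) ^ 2 * t ^ 2 / 2) := by
          rw [integral_const_mul]
          gcongr
          exact integral_exp_sub_integral_le_of_forall_abs_sub_le μ hgm hgosc t
      _ = Real.exp ((n + 1 : ℕ) * (c / 2) ^ 2 * t ^ 2 / 2) := by
          rw [← Real.exp_add]; congr 1; push_cast; ring

theorem hasSubgaussianMGF_of_bounded_differences {𝒵 : Type*} [MeasurableSpace 𝒵]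
    (μ : Measure 𝒵) [IsProbabilityMeasure μ] {c M : ℝ} {n : ℕ} {f : (Fin n → 𝒵) → ℝ}
    (hf : Measurable f) (hM : ∀ z, |f z| ≤ M)
    (hc : ∀ z i a, |f (Function.update z i a) - f z| ≤ c) :
    HasSubgaussianMGF (fun z => f z - ∫ w, f w ∂Measure.pi fun _ => μ)
      (n * (c / 2) ^ 2).toNNReal (Measure.pi fun _ => μ) where
  integrable_exp_mul t := by
    refine Integrable.of_bound (by fun_prop) (Real.exp (|t| * (2 * M)))
      (Filter.Eventually.of_forall fun z => ?_)
    have hE : |∫ w, f w ∂Measure.pi fun _ : Fin n => μ| ≤ M := by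
      simpa using norm_integral_le_of_norm_le_const (μ := Measure.pi fun _ : Fin n => μ) (f := f)
        (Filter.Eventually.of_forall fun w => hM _)
    rw [Real.norm_eq_abs, Real.abs_exp, Real.exp_le_exp]
    refine (le_abs_self _).trans ?_
    rw [abs_mul]
    gcongr
    exact (abs_sub _ _).trans (by linarith [hM z])
  mgf_le t := by
    rw [Real.coe_toNNReal _ (by positivity)]
    exact integral_exp_sub_integral_le_of_bounded_differences μ t hf hM hc

/-! ### Rademacher complexity of finite classes -/

lemma abs_signVal (s : ℤˣ) : |signVal s| = 1 := by
  rcases Int.units_eq_one_or s with rfl | rfl <;> simp [signVal]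

lemma signVal_neg (s : ℤˣ) : signVal (-s) = -signVal s := by
  simp [signVal]

lemma signVal_mul (s s' : ℤˣ) : signVal (s * s') = signVal s * signVal s' := by
  simp [signVal]

lemma sum_signVal_mul {n : ℕ} (b : Fin n → ℝ) :
    ∑ σ : Fin n → ℤˣ, ∑ j, signVal (σ j) * b j = 0 := by
  have h : ∑ σ : Fin n → ℤˣ, ∑ j, signVal (σ j) * b j
      = ∑ σ : Fin n → ℤˣ, -∑ j, signVal (σ j) * b j := by
    refine Fintype.sum_equiv (Equiv.neg _) _ _ fun σ => ?_
    simp [signVal_neg]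
  rw [Finset.sum_neg_distrib] at h
  linarith

lemma empRademacher_range {ι 𝒵 : Type*} {n : ℕ} (F : ι → 𝒵 → ℝ) (x : Fin n → 𝒵) :
    empRademacher (Set.range F) x
      = (1 / 2 ^ n) * ∑ σ : Fin n → ℤˣ, ⨆ i, (1 / (n : ℝ)) * ∑ j, signVal (σ j) * F i (x j) := by
  unfold empRademacher
  congr 1
  refine Finset.sum_congr rfl fun σ _ => ?_
  exact iSup_range' (fun f : 𝒵 → ℝ => (1 / (n : ℝ)) * ∑ j, signVal (σ j) * f (x j)) F

lemma abs_iSup_le {ι : Type*} [Nonempty ι] {f : ι → ℝ} {M : ℝ} (h : ∀ i, |f i| ≤ M) :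
    |⨆ i, f i| ≤ M := by
  have hb : BddAbove (Set.range f) := ⟨M, by rintro _ ⟨i, rfl⟩; exact (abs_le.1 (h i)).2⟩
  refine abs_le.2 ⟨?_, ciSup_le fun i => (abs_le.1 (h i)).2⟩
  obtain ⟨i⟩ := ‹Nonempty ι›
  exact (abs_le.1 (h i)).1.trans (le_ciSup hb i)

lemma abs_iSup_sub_iSup_le {ι : Type*} [Finite ι] [Nonempty ι] {f g : ι → ℝ} {M : ℝ}
    (h : ∀ i, |f i - g i| ≤ M) : |(⨆ i, f i) - ⨆ i, g i| ≤ M := by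
  have hb : ∀ f : ι → ℝ, BddAbove (Set.range f) := fun f => (Set.finite_range f).bddAbove
  refine abs_sub_le_iff.2 ⟨?_, ?_⟩
  · have : (⨆ i, f i) ≤ (⨆ i, g i) + M := ciSup_le fun i => by
      linarith [le_ciSup (hb g) i, (abs_le.1 (h i)).2]
    linarith
  · have : (⨆ i, g i) ≤ (⨆ i, f i) + M := ciSup_le fun i => by
      linarith [le_ciSup (hb f) i, (abs_le.1 (h i)).1]
    linarith

lemma abs_average_le {n : ℕ} {f : Fin n → ℝ} {M : ℝ} (hM : 0 ≤ M) (h : ∀ j, |f j| ≤ M) :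
    |(1 / (n : ℝ)) * ∑ j, f j| ≤ M := by
  rcases Nat.eq_zero_or_pos n with rfl | hn
  · simpa using hM
  rw [abs_mul, abs_of_nonneg (by positivity : (0 : ℝ) ≤ 1 / n)]
  have : |∑ j, f j| ≤ n * M := (Finset.abs_sum_le_sum_abs _ _).trans
    ((Finset.sum_le_sum fun j _ => h j).trans (by simp))
  calc 1 / (n : ℝ) * |∑ j, f j| ≤ 1 / n * (n * M) := by gcongr
    _ = M := by field_simp

lemma measurable_empRademacher {ι 𝒵 : Type*} [MeasurableSpace 𝒵] [Finite ι] {n : ℕ}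
    {F : ι → 𝒵 → ℝ} (hF : ∀ i, Measurable (F i)) :
    Measurable fun x : Fin n → 𝒵 => empRademacher (Set.range F) x := by
  simp_rw [empRademacher_range]
  refine Measurable.const_mul (Finset.measurable_sum _ fun σ _ => Measurable.iSup fun i => ?_) _
  exact Measurable.const_mul (Finset.measurable_sum _ fun j _ =>
    ((hF i).comp (measurable_pi_apply j)).const_mul _) _

lemma abs_empRademacher_le {ι 𝒵 : Type*} [Nonempty ι] {n : ℕ}
    {F : ι → 𝒵 → ℝ} {M : ℝ} (hM : ∀ i z, |F i z| ≤ M) (x : Fin n → 𝒵) (hM0 : 0 ≤ M) :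
    |empRademacher (Set.range F) x| ≤ M := by
  rw [empRademacher_range, abs_mul, abs_of_nonneg (by positivity : (0 : ℝ) ≤ 1 / 2 ^ n)]
  have : |∑ σ : Fin n → ℤˣ, ⨆ i, (1 / (n : ℝ)) * ∑ j, signVal (σ j) * F i (x j)| ≤ 2 ^ n * M := by
    refine (Finset.abs_sum_le_sum_abs _ _).trans ((Finset.sum_le_sum fun σ _ =>
      abs_iSup_le (M := M) fun i => abs_average_le hM0 fun j => ?_).trans ?_)
    · rw [abs_mul, abs_signVal, one_mul]; exact hM _ _
    · simp
  calc 1 / 2 ^ n * _ ≤ 1 / 2 ^ n * (2 ^ n * M) := by gcongr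
    _ = M := by field_simp

/-- The largest amount by which the mean of a member of the family `F` exceeds its empirical
average over the sample `z`. -/
noncomputable def supDeviation {ι 𝒵 : Type*} [MeasurableSpace 𝒵] (μ : Measure 𝒵) (F : ι → 𝒵 → ℝ) {n : ℕ}
    (z : Fin n → 𝒵) : ℝ :=
  ⨆ i, (∫ x, F i x ∂μ - (1 / (n : ℝ)) * ∑ j, F i (z j))

section Symmetrization

variable {ι 𝒵 : Type*} [MeasurableSpace 𝒵] {μ : Measure 𝒵} {F : ι → 𝒵 → ℝ} {M : ℝ}
  {n : ℕ}

lemma measurable_supDeviation [Finite ι] (hF : ∀ i, Measurable (F i)) :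
    Measurable fun z : Fin n → 𝒵 => supDeviation μ F z :=
  Measurable.iSup fun i => measurable_const.sub (Measurable.const_mul
    (Finset.measurable_sum _ fun j _ => (hF i).comp (measurable_pi_apply j)) _)

lemma le_supDeviation [Finite ι] (i : ι) (z : Fin n → 𝒵) :
    ∫ x, F i x ∂μ - (1 / (n : ℝ)) * ∑ j, F i (z j) ≤ supDeviation μ F z :=
  le_ciSup (f := fun i => ∫ x, F i x ∂μ - (1 / (n : ℝ)) * ∑ j, F i (z j))
    (Set.finite_range _).bddAbove i

variable [IsProbabilityMeasure μ]

lemma abs_integral_le_of_abs_le {f : 𝒵 → ℝ} (h : ∀ z, |f z| ≤ M) : |∫ z, f z ∂μ| ≤ M := by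
  simpa using norm_integral_le_of_norm_le_const (μ := μ) (f := f)
    (Filter.Eventually.of_forall h)

lemma integrable_of_abs_le {f : 𝒵 → ℝ} (hf : Measurable f) (h : ∀ z, |f z| ≤ M) :
    Integrable f μ :=
  Integrable.of_bound hf.aestronglyMeasurable M (Filter.Eventually.of_forall h)

lemma integral_pi_average {f : 𝒵 → ℝ} (hf : Measurable f) (hM : ∀ z, |f z| ≤ M) (hn : 1 ≤ n) :
    ∫ z : Fin n → 𝒵, (1 / (n : ℝ)) * ∑ j, f (z j) ∂(Measure.pi fun _ => μ) = ∫ x, f x ∂μ := by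
  have hj : ∀ j : Fin n, MeasurePreserving (fun z : Fin n → 𝒵 => z j) (Measure.pi fun _ => μ) μ :=
    fun j => measurePreserving_eval (fun _ => μ) j
  have hi : ∀ j : Fin n, Integrable (fun z : Fin n → 𝒵 => f (z j)) (Measure.pi fun _ => μ) :=
    fun j => integrable_of_abs_le (hf.comp (measurable_pi_apply j)) fun z => hM (z j)
  rw [integral_const_mul, integral_finsetSum _ fun j _ => hi j]
  have : ∀ j : Fin n, ∫ z : Fin n → 𝒵, f (z j) ∂(Measure.pi fun _ => μ) = ∫ x, f x ∂μ := fun j => by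
    conv_rhs => rw [← (hj j).map_eq]
    rw [integral_map (hj j).measurable.aemeasurable hf.aestronglyMeasurable]
  have hn' : (n : ℝ) ≠ 0 := by positivity
  simp [this]
  field_simp

lemma abs_supDeviation_le [Nonempty ι] (hM : ∀ i z, |F i z| ≤ M) (hM0 : 0 ≤ M) (z : Fin n → 𝒵) :
    |supDeviation μ F z| ≤ 2 * M := by
  refine abs_iSup_le fun i => (abs_sub _ _).trans ?_
  linarith [abs_integral_le_of_abs_le (μ := μ) (hM i),
    abs_average_le hM0 fun j => hM i (z j)]

/-- Exchange of the two members of a pair of samples, when the sign is `-1`. -/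
def signSwap (s : ℤˣ) (q : 𝒵 × 𝒵) : 𝒵 × 𝒵 := if s = 1 then q else q.swap

lemma measurePreserving_signSwap (s : ℤˣ) :
    MeasurePreserving (signSwap s) (μ.prod μ) (μ.prod μ) := by
  rcases Int.units_eq_one_or s with rfl | rfl
  · exact MeasurePreserving.id (μ.prod μ)
  · exact Measure.measurePreserving_swap (μ := μ) (ν := μ)

/-- **Symmetrisation**: on average, the uniform deviation of a finite class is at most twice its
Rademacher complexity. -/
theorem integral_supDeviation_le [Finite ι] [Nonempty ι] (hF : ∀ i, Measurable (F i))
    (hM : ∀ i z, |F i z| ≤ M) (hn : 1 ≤ n) :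
    ∫ z : Fin n → 𝒵, supDeviation μ F z ∂(Measure.pi fun _ => μ)
      ≤ 2 * rademacher n μ (Set.range F) := by
  obtain ⟨z₀⟩ := nonempty_of_isProbabilityMeasure μ
  have hM0 : 0 ≤ M := (abs_nonneg _).trans (hM (Classical.arbitrary ι) z₀)
  have hbdd : ∀ f : ι → ℝ, BddAbove (Set.range f) := fun f => (Set.finite_range f).bddAbove
  set ν : Measure (Fin n → 𝒵) := Measure.pi fun _ => μ with hν
  set ρ : Measure (Fin n → 𝒵 × 𝒵) := Measure.pi fun _ => μ.prod μ with hρ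
  set Ψ : (Fin n → ℤˣ) → (Fin n → 𝒵 × 𝒵) → ℝ := fun σ w =>
    ⨆ i, (1 / (n : ℝ)) * ∑ j, signVal (σ j) * (F i (w j).2 - F i (w j).1) with hΨ
  have hF1 : ∀ i (j : Fin n), Measurable fun w : Fin n → 𝒵 × 𝒵 => F i (w j).1 := fun i j =>
    (hF i).comp (measurable_fst.comp (measurable_pi_apply j))
  have hF2 : ∀ i (j : Fin n), Measurable fun w : Fin n → 𝒵 × 𝒵 => F i (w j).2 := fun i j =>
    (hF i).comp (measurable_snd.comp (measurable_pi_apply j))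
  have hΨm : ∀ σ, Measurable (Ψ σ) := fun σ => Measurable.iSup fun i =>
    Measurable.const_mul (Finset.measurable_sum _ fun j _ =>
      ((hF2 i j).sub (hF1 i j)).const_mul _) _
  have hΨb : ∀ σ w, |Ψ σ w| ≤ 2 * M := fun σ w => by
    refine abs_iSup_le fun i => abs_average_le (by positivity) fun j => ?_
    rw [abs_mul, abs_signVal, one_mul]
    exact (abs_sub _ _).trans (by linarith [hM i (w j).1, hM i (w j).2])
  -- A ghost sample replaces the means.
  have hghost : ∫ z, supDeviation μ F z ∂ν ≤ ∫ w, Ψ 1 w ∂ρ := by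
    have hmp := (measurePreserving_arrowProdEquivProdArrow 𝒵 𝒵 (Fin n)
      (fun _ => μ) (fun _ => μ)).symm
    have hK : Integrable (fun q => Ψ 1 ((MeasurableEquiv.arrowProdEquivProdArrow 𝒵 𝒵 (Fin n)).symm
        q)) (ν.prod ν) := integrable_of_abs_le ((hΨm 1).comp hmp.measurable) fun q => hΨb _ _
    rw [hρ, ← hmp.map_eq, integral_map hmp.measurable.aemeasurable (hΨm 1).aestronglyMeasurable,
      integral_prod _ hK]
    refine integral_mono (integrable_of_abs_le (measurable_supDeviation hF)
      (abs_supDeviation_le hM hM0)) ?_ fun z => ?_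
    · exact hK.integral_prod_left
    · refine ciSup_le fun i => ?_
      rw [← integral_pi_average (hF i) (hM i) hn]
      have hint : Integrable (fun z' : Fin n → 𝒵 => (1 / (n : ℝ)) * ∑ j, F i (z' j)) ν :=
        integrable_of_abs_le (Measurable.const_mul (Finset.measurable_sum _ fun j _ =>
          (hF i).comp (measurable_pi_apply j)) _) fun z' => abs_average_le hM0 fun j => hM _ _
      have : ∫ z' : Fin n → 𝒵, (1 / (n : ℝ)) * ∑ j, F i (z' j) ∂ν
          - 1 / (n : ℝ) * ∑ j, F i (z j)
          = ∫ z' : Fin n → 𝒵, ((1 / (n : ℝ)) * ∑ j, F i (z' j)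
            - 1 / (n : ℝ) * ∑ j, F i (z j)) ∂ν := by
        rw [integral_sub hint (integrable_const _)]; simp
      rw [this]
      refine integral_mono (hint.sub (integrable_const _)) (integrable_of_abs_le
        (((hΨm 1).comp hmp.measurable).comp measurable_prodMk_left) fun q => hΨb _ _) fun z' => ?_
      refine le_trans (le_of_eq ?_) (le_ciSup (f := fun i => (1 / (n : ℝ)) * ∑ j,
        signVal ((1 : Fin n → ℤˣ) j) * (F i (z' j) - F i (z j))) (hbdd _) i)
      simp [signVal, mul_sub]
  -- Exchanging a sample with its ghost does not change the law.
  have hswap : ∀ σ, ∫ w, Ψ σ w ∂ρ = ∫ w, Ψ 1 w ∂ρ := fun σ => by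
    have hmp := measurePreserving_pi (fun _ : Fin n => μ.prod μ) (fun _ => μ.prod μ)
      (f := fun j => signSwap (σ j)) fun j => measurePreserving_signSwap (σ j)
    conv_rhs => rw [hρ, ← hmp.map_eq]
    rw [integral_map hmp.measurable.aemeasurable (hΨm 1).aestronglyMeasurable]
    refine integral_congr_ae (Filter.Eventually.of_forall fun w => ?_)
    simp only [hΨ]
    refine iSup_congr fun i => ?_
    congr 1
    refine Finset.sum_congr rfl fun j _ => ?_
    rcases Int.units_eq_one_or (σ j) with h | h <;> simp [h, signSwap, signVal]
  have hsum : (1 / 2 ^ n) * ∑ σ : Fin n → ℤˣ, ∫ w, Ψ σ w ∂ρ = ∫ w, Ψ 1 w ∂ρ := by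
    simp [hswap]
  have hR : ∀ π : 𝒵 × 𝒵 → 𝒵, MeasurePreserving π (μ.prod μ) μ →
      ∫ w, empRademacher (Set.range F) (fun j => π (w j)) ∂ρ = rademacher n μ (Set.range F) := by
    intro π hπ
    have hmp := measurePreserving_pi (fun _ : Fin n => μ.prod μ) (fun _ => μ)
      (f := fun _ => π) fun _ => hπ
    unfold rademacher
    rw [← hmp.map_eq, integral_map hmp.measurable.aemeasurable
      (measurable_empRademacher hF).aestronglyMeasurable]
  have hRi : ∀ π : 𝒵 × 𝒵 → 𝒵, Measurable π →
      Integrable (fun w : Fin n → 𝒵 × 𝒵 => empRademacher (Set.range F) (fun j => π (w j))) ρ :=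
    fun π hπ => integrable_of_abs_le ((measurable_empRademacher hF).comp
      (measurable_pi_lambda _ fun j => hπ.comp (measurable_pi_apply j)))
      fun w => abs_empRademacher_le hM _ hM0
  have hpt : ∀ w, (1 / 2 ^ n) * ∑ σ : Fin n → ℤˣ, Ψ σ w
      ≤ empRademacher (Set.range F) (fun j => (w j).2)
        + empRademacher (Set.range F) (fun j => (w j).1) := by
    intro w
    -- The reflection `σ ↦ -σ` turns the second half into a Rademacher average.
    have hneg : ∑ σ : Fin n → ℤˣ, ⨆ i, (1 / (n : ℝ)) * ∑ j, signVal (σ j) * F i (w j).1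
        = ∑ σ : Fin n → ℤˣ, ⨆ i, (1 / (n : ℝ)) * ∑ j, -signVal (σ j) * F i (w j).1 := by
      refine Fintype.sum_equiv (Equiv.neg _) _ _ fun σ => ?_
      simp [signVal_neg]
    rw [empRademacher_range, empRademacher_range, hneg, ← mul_add, ← Finset.sum_add_distrib]
    refine mul_le_mul_of_nonneg_left (Finset.sum_le_sum fun σ _ => ciSup_le fun i => ?_)
      (by positivity)
    refine le_trans (le_of_eq ?_) (add_le_add (le_ciSup (hbdd fun i => (1 / (n : ℝ)) *
      ∑ j, signVal (σ j) * F i (w j).2) i) (le_ciSup (hbdd fun i => (1 / (n : ℝ)) *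
      ∑ j, -signVal (σ j) * F i (w j).1) i))
    rw [← mul_add, ← Finset.sum_add_distrib]
    congr 1
    exact Finset.sum_congr rfl fun j _ => by ring
  calc ∫ z, supDeviation μ F z ∂ν ≤ ∫ w, Ψ 1 w ∂ρ := hghost
    _ = ∫ w, (1 / 2 ^ n) * ∑ σ : Fin n → ℤˣ, Ψ σ w ∂ρ := by
        rw [← hsum, integral_const_mul,
          integral_finsetSum _ fun σ _ => integrable_of_abs_le (hΨm σ) (hΨb σ)]
    _ ≤ ∫ w, (empRademacher (Set.range F) (fun j => (w j).2)
          + empRademacher (Set.range F) (fun j => (w j).1)) ∂ρ :=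
        integral_mono ((integrable_finsetSum _ fun σ _ =>
          integrable_of_abs_le (hΨm σ) (hΨb σ)).const_mul _)
          ((hRi _ measurable_snd).add (hRi _ measurable_fst)) hpt
    _ = 2 * rademacher n μ (Set.range F) := by
        rw [integral_add (hRi _ measurable_snd) (hRi _ measurable_fst),
          hR _ measurePreserving_snd, hR _ measurePreserving_fst, two_mul]

end Symmetrization

/-! ### Contraction and sequential Rademacher complexity -/

/-- Multiplying the values of a finite class at the `j`-th point by a factor of modulus at most `c`
increases Rademacher averages by at most the factor `c`: the average is convex in the vector of
factors, so it is largest at a vertex of the cube, and there it is `c` times the original average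
by the symmetry of the signs. -/
lemma sum_iSup_signVal_mul_le {ι : Type*} [Finite ι] [Nonempty ι] {n : ℕ} {a : Fin n → ℝ} {c : ℝ}
    (hc : 0 ≤ c) (ha : ∀ j, |a j| ≤ c) (t : ι → Fin n → ℝ) :
    ∑ σ : Fin n → ℤˣ, ⨆ i, ∑ j, signVal (σ j) * (a j * t i j)
      ≤ c * ∑ σ : Fin n → ℤˣ, ⨆ i, ∑ j, signVal (σ j) * t i j := by
  have hbdd : ∀ f : ι → ℝ, BddAbove (Set.range f) := fun f => (Set.finite_range f).bddAbove
  set φ : (Fin n → ℝ) → ℝ := fun a =>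
    ∑ σ : Fin n → ℤˣ, ⨆ i, ∑ j, signVal (σ j) * (a j * t i j) with hφ
  have hconv : ConvexOn ℝ Set.univ φ := by
    refine ⟨convex_univ, fun x _ y _ p q hp hq _ => ?_⟩
    simp only [hφ, smul_eq_mul, Finset.mul_sum, ← Finset.sum_add_distrib]
    refine Finset.sum_le_sum fun σ _ => ciSup_le fun i => ?_
    have h1 := mul_le_mul_of_nonneg_left
      (le_ciSup (hbdd fun i => ∑ j, signVal (σ j) * (x j * t i j)) i) hp
    have h2 := mul_le_mul_of_nonneg_left
      (le_ciSup (hbdd fun i => ∑ j, signVal (σ j) * (y j * t i j)) i) hq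
    refine le_trans (le_of_eq ?_) (add_le_add h1 h2)
    rw [Finset.mul_sum, Finset.mul_sum, ← Finset.sum_add_distrib]
    refine Finset.sum_congr rfl fun j _ => ?_
    simp only [Pi.add_apply, Pi.smul_apply, smul_eq_mul]
    ring
  have hmem : a ∈ convexHull ℝ (Set.univ.pi fun _ : Fin n => ({-c, c} : Set ℝ)) := by
    rw [convexHull_pi]
    intro j _
    rw [convexHull_pair, segment_eq_Icc (by linarith)]
    exact abs_le.1 (ha j)
  obtain ⟨v, hv, hle⟩ := hconv.exists_ge_of_mem_convexHull (Set.subset_univ _) hmem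
  refine hle.trans (le_of_eq ?_)
  have hτ : ∀ j, ∃ s : ℤˣ, v j = c * signVal s := fun j => by
    rcases hv j (Set.mem_univ j) with h | h
    · exact ⟨-1, by rw [h]; simp [signVal]⟩
    · exact ⟨1, by rw [h]; simp [signVal]⟩
  choose τ hτ using hτ
  rw [Finset.mul_sum]
  refine Fintype.sum_equiv (Equiv.mulRight τ) _ _ fun σ => ?_
  rw [Real.mul_iSup_of_nonneg hc]
  refine iSup_congr fun i => ?_
  rw [Finset.mul_sum]
  refine Finset.sum_congr rfl fun j _ => ?_
  simp only [hτ j, Equiv.coe_mulRight, Pi.mul_apply, signVal_mul]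
  ring

/-- **Contraction** for a class of functions that are affine in the members of another class, with
coefficients that depend on the point only. -/
lemma empRademacher_affine_le {ι 𝒵 𝒲 : Type*} [Finite ι] [Nonempty ι] {n : ℕ} {G : ι → 𝒲 → ℝ}
    {F : ι → 𝒵 → ℝ} {π : 𝒵 → 𝒲} {a b : 𝒵 → ℝ} {c : ℝ} (hc : 0 ≤ c) (ha : ∀ z, |a z| ≤ c)
    (hF : ∀ i z, F i z = b z + a z * G i (π z)) (x : Fin n → 𝒵) :
    empRademacher (Set.range F) x ≤ c * empRademacher (Set.range G) (π ∘ x) := by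
  rw [empRademacher_range, empRademacher_range]
  have hn : (0 : ℝ) ≤ 1 / n := by positivity
  simp_rw [← Real.mul_iSup_of_nonneg hn, ← Finset.mul_sum]
  have hF' : ∀ σ : Fin n → ℤˣ, ⨆ i, ∑ j, signVal (σ j) * F i (x j)
      = ∑ j, signVal (σ j) * b (x j)
        + ⨆ i, ∑ j, signVal (σ j) * (a (x j) * G i (π (x j))) := by
    intro σ
    rw [add_ciSup (Set.finite_range _).bddAbove]
    refine iSup_congr fun i => ?_
    rw [← Finset.sum_add_distrib]
    exact Finset.sum_congr rfl fun j _ => by rw [hF]; ring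
  simp_rw [hF']
  rw [Finset.sum_add_distrib, sum_signVal_mul, zero_add]
  have := sum_iSup_signVal_mul_le hc (fun j => ha (x j)) fun i j => G i (π (x j))
  calc _ ≤ 1 / 2 ^ n * (1 / (n : ℝ) * (c * ∑ σ : Fin n → ℤˣ,
        ⨆ i, ∑ j, signVal (σ j) * G i (π (x j)))) := by gcongr
    _ = _ := by simp only [Function.comp_apply]; ring

lemma seqRademacher_range {ι 𝒵 : Type*} {N : ℕ} (F : ι → 𝒵 → ℝ) :
    seqRademacher N (Set.range F) = ⨆ z : (t : Fin N) → (Fin t → ℤˣ) → 𝒵,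
      (1 / 2 ^ N) * ∑ σ : Fin N → ℤˣ, ⨆ i, (1 / (N : ℝ)) * ∑ t : Fin N,
        signVal (σ t) * F i (z t fun s => σ (Fin.castLE t.isLt.le s)) := by
  unfold seqRademacher
  refine iSup_congr fun z => ?_
  congr 1
  refine Finset.sum_congr rfl fun σ _ => ?_
  exact iSup_range' (fun f : 𝒵 → ℝ => (1 / (N : ℝ)) * ∑ t : Fin N,
    signVal (σ t) * f (z t fun s => σ (Fin.castLE t.isLt.le s))) F

/-- A constant tree turns a sequential Rademacher average into an ordinary one. -/
lemma empRademacher_le_seqRademacher {ι 𝒵 : Type*} [Nonempty ι] {F : ι → 𝒵 → ℝ} {M : ℝ}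
    (hM : ∀ i z, |F i z| ≤ M) (hM0 : 0 ≤ M) {N : ℕ} (x : Fin N → 𝒵) :
    empRademacher (Set.range F) x ≤ seqRademacher N (Set.range F) := by
  rw [empRademacher_range, seqRademacher_range]
  refine le_ciSup (f := fun z : (t : Fin N) → (Fin t → ℤˣ) → 𝒵 =>
    (1 / 2 ^ N) * ∑ σ : Fin N → ℤˣ, ⨆ i, (1 / (N : ℝ)) * ∑ t : Fin N,
      signVal (σ t) * F i (z t fun s => σ (Fin.castLE t.isLt.le s)))
    ⟨(1 / 2 ^ N) * ∑ σ : Fin N → ℤˣ, M, ?_⟩ (fun t _ => x t)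
  rintro _ ⟨z, rfl⟩
  refine mul_le_mul_of_nonneg_left (Finset.sum_le_sum fun σ _ => ?_) (by positivity)
  refine (abs_le.1 (abs_iSup_le fun i => abs_average_le hM0 fun j => ?_)).2
  rw [abs_mul, abs_signVal, one_mul]
  exact hM _ _

lemma empRademacher_nonneg {ι 𝒵 : Type*} [Finite ι] [Nonempty ι] {n : ℕ} (F : ι → 𝒵 → ℝ)
    (x : Fin n → 𝒵) : 0 ≤ empRademacher (Set.range F) x := by
  rw [empRademacher_range]
  refine mul_nonneg (by positivity) ?_
  have h0 : ∑ σ : Fin n → ℤˣ, (1 / (n : ℝ)) *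
      ∑ j, signVal (σ j) * F (Classical.arbitrary ι) (x j) = 0 := by
    rw [← Finset.mul_sum, sum_signVal_mul, mul_zero]
  rw [← h0]
  exact Finset.sum_le_sum fun σ _ => le_ciSup (f := fun i => (1 / (n : ℝ)) *
    ∑ j, signVal (σ j) * F i (x j)) (Set.finite_range _).bddAbove _

lemma rademacher_le_seqRademacher {ι 𝒵 : Type*} [MeasurableSpace 𝒵] [Finite ι] [Nonempty ι]
    {μ : Measure 𝒵} [IsProbabilityMeasure μ] {F : ι → 𝒵 → ℝ} (hF : ∀ i, Measurable (F i)) {M : ℝ}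
    (hM : ∀ i z, |F i z| ≤ M) (hM0 : 0 ≤ M) (N : ℕ) :
    rademacher N μ (Set.range F) ≤ seqRademacher N (Set.range F) := by
  have := integral_mono (μ := Measure.pi fun _ : Fin N => μ)
    (integrable_of_abs_le (measurable_empRademacher hF) fun x => abs_empRademacher_le hM x hM0)
    (integrable_const (seqRademacher N (Set.range F)))
    fun x => empRademacher_le_seqRademacher hM hM0 x
  simpa [rademacher] using this

lemma rademacher_affine_le {ι 𝒵 𝒲 : Type*} [MeasurableSpace 𝒵] [MeasurableSpace 𝒲] [Finite ι]
    [Nonempty ι] {μ : Measure 𝒵} [IsProbabilityMeasure μ] {n : ℕ} {G : ι → 𝒲 → ℝ}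
    {F : ι → 𝒵 → ℝ} {π : 𝒵 → 𝒲} (hπ : Measurable π) (hFm : ∀ i, Measurable (F i))
    (hGm : ∀ i, Measurable (G i)) {M : ℝ} (hFM : ∀ i z, |F i z| ≤ M) (hGM : ∀ i w, |G i w| ≤ M)
    (hM0 : 0 ≤ M) {a b : 𝒵 → ℝ} {c : ℝ} (hc : 0 ≤ c) (ha : ∀ z, |a z| ≤ c)
    (hF : ∀ i z, F i z = b z + a z * G i (π z)) :
    rademacher n μ (Set.range F) ≤ c * rademacher n (μ.map π) (Set.range G) := by
  have : IsProbabilityMeasure (μ.map π) := Measure.isProbabilityMeasure_map hπ.aemeasurable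
  have hmp := measurePreserving_pi (fun _ : Fin n => μ) (fun _ => μ.map π)
    (f := fun _ => π) fun _ => ⟨hπ, rfl⟩
  unfold rademacher
  rw [← hmp.map_eq, integral_map hmp.measurable.aemeasurable
    (measurable_empRademacher hGm).aestronglyMeasurable, ← integral_const_mul]
  refine integral_mono (integrable_of_abs_le (measurable_empRademacher hFm)
    fun x => abs_empRademacher_le hFM x hM0) (Integrable.const_mul (integrable_of_abs_le
      ((measurable_empRademacher hGm).comp hmp.measurable)
      fun x => abs_empRademacher_le hGM _ hM0) _) fun x => ?_
  exact empRademacher_affine_le hc ha hF x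

/-! ### Lipschitz classifiers and the loss -/

lemma Label.eq_neg_one_or_eq_one (a : Label) : (a : ℝ) = -1 ∨ (a : ℝ) = 1 := a.2

lemma Label.abs_coe (a : Label) : |(a : ℝ)| = 1 := by
  rcases a.eq_neg_one_or_eq_one with h | h <;> simp [h]

lemma Label.eq_of_abs_sub_lt {a b : Label} (h : |(a : ℝ) - b| < 2) : a = b := by
  refine Subtype.ext ?_
  rcases a.eq_neg_one_or_eq_one with ha | ha <;> rcases b.eq_neg_one_or_eq_one with hb | hb <;>
    rw [ha, hb] at h ⊢ <;> norm_num at h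

/-- A Lipschitz function with values in `{-1, 1}` is constant on small balls, so over a compact
space there are only finitely many of them. -/
lemma finite_of_lipschitz {E : Type*} [PseudoMetricSpace E] [CompactSpace E] {H : Set (E → Label)}
    {R : ℝ} (hR : 0 ≤ R) (hH : ∀ h ∈ H, ∀ x x', |(h x : ℝ) - h x'| ≤ R * dist x x') :
    H.Finite := by
  obtain ⟨t, -, ht, hcov⟩ := (isCompact_univ (X := E)).finite_cover_balls
    (e := 1 / (R + 1)) (by positivity)
  have := ht.to_subtype
  have hinj : Function.Injective fun (h : H) (c : t) => h.1 c := by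
    intro h h' hhh
    refine Subtype.ext (funext fun x => ?_)
    obtain ⟨c, hc, hx⟩ : ∃ c ∈ t, dist x c < 1 / (R + 1) := by
      simpa using hcov (Set.mem_univ x)
    have hlt : R * dist x c < 2 := by
      have : R * dist x c ≤ R * (1 / (R + 1)) := by gcongr
      have : R * (1 / (R + 1)) ≤ 1 := by rw [mul_one_div, div_le_one (by positivity)]; linarith
      linarith
    have h1 : h.1 x = h.1 c := Label.eq_of_abs_sub_lt ((hH _ h.2 x c).trans_lt hlt)
    have h2 : h'.1 x = h'.1 c := Label.eq_of_abs_sub_lt ((hH _ h'.2 x c).trans_lt hlt)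
    rw [h1, h2]
    exact congrFun hhh ⟨c, hc⟩
  exact Set.finite_coe_iff.1 (Finite.of_injective _ hinj)

lemma measurable_of_lipschitz {E : Type*} [PseudoMetricSpace E] [MeasurableSpace E]
    [OpensMeasurableSpace E] {h : E → Label} {R : ℝ} (hR : 0 ≤ R)
    (hh : ∀ x x', |(h x : ℝ) - h x'| ≤ R * dist x x') : Measurable h := by
  have : Continuous fun x => (h x : ℝ) :=
    (LipschitzWith.of_dist_le_mul (K := R.toNNReal) fun x x' => by
      rw [Real.coe_toNNReal _ hR, Real.dist_eq]; exact hh x x').continuous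
  exact (continuous_induced_rng.2 this).measurable

lemma measurable_loss {𝒳 : Type*} [MeasurableSpace 𝒳] (ℓ : Label → Label → ℝ) {h : 𝒳 → Label}
    (hh : Measurable h) : Measurable fun z : 𝒳 × Label => ℓ (h z.1) z.2 := by
  have : Measurable fun q : Label × Label => ℓ q.1 q.2 := measurable_of_countable _
  exact this.comp ((hh.comp measurable_fst).prodMk measurable_snd)

/-- A loss on `{-1, 1}` is affine in its first argument, with slope at most its Lipschitz constant
and at most its bound. -/
lemma exists_loss_eq_affine {ℓ : Label → Label → ℝ} {L B : ℝ} (hB : ∀ a y, |ℓ a y| ≤ B)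
    (hL : ∀ a a' y, |ℓ a y - ℓ a' y| ≤ L * |(a : ℝ) - (a' : ℝ)|) :
    ∃ u v : Label → ℝ, (∀ y, |v y| ≤ L) ∧ (∀ y, |v y| ≤ B) ∧
      ∀ a y, ℓ a y = u y + v y * (a : ℝ) := by
  let p : Label := ⟨1, by simp⟩
  let m : Label := ⟨-1, by simp⟩
  refine ⟨fun y => (ℓ p y + ℓ m y) / 2, fun y => (ℓ p y - ℓ m y) / 2, fun y => ?_, fun y => ?_,
    fun a y => ?_⟩
  · have := hL p m y
    have h2 : |(p : ℝ) - m| = 2 := by norm_num [p, m]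
    rw [abs_div, abs_two]
    rw [h2] at this
    linarith
  · rw [abs_div, abs_two]
    linarith [abs_sub (ℓ p y) (ℓ m y), hB p y, hB m y]
  · rcases a.eq_neg_one_or_eq_one with h | h
    · rw [show a = m from Subtype.ext h]; simp [m]; ring
    · rw [show a = p from Subtype.ext h]; simp [p]; ring

/-! ### Wasserstein distance and the change of domain -/

section Wasserstein

variable {d : ℕ} {X : Set (EuclideanSpace ℝ (Fin d))}

lemma sampleDist_nonneg (p : ℝ) (z₁ z₂ : Sample X) : 0 ≤ sampleDist p z₁ z₂ := by
  unfold sampleDist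
  positivity

lemma continuous_sampleDist {p : ℝ} (hp : 1 ≤ p) :
    Continuous fun w : Sample X × Sample X => sampleDist p w.1 w.2 := by
  unfold sampleDist
  have hp0 : 0 ≤ p := by linarith
  refine Continuous.rpow_const (Continuous.add (continuous_finsetSum _ fun i _ =>
    Continuous.rpow_const ?_ fun _ => Or.inr hp0) (Continuous.rpow_const ?_ fun _ => Or.inr hp0))
    fun _ => Or.inr (by positivity)
  · fun_prop
  · fun_prop

/-- For `p ≤ 2` the Euclidean distance of two samples is at most their `p`-distance. -/
lemma sqrt_le_sampleDist {p : ℝ} (hp1 : 1 ≤ p) (hp2 : p ≤ 2) (z₁ z₂ : Sample X) :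
    √(‖(z₁.1 : EuclideanSpace ℝ (Fin d)) - z₂.1‖ ^ 2 + |(z₁.2 : ℝ) - z₂.2| ^ 2)
      ≤ sampleDist p z₁ z₂ := by
  have hp0 : 0 < p := by linarith
  refine Real.sqrt_le_iff.2 ⟨sampleDist_nonneg _ _ _, ?_⟩
  rw [EuclideanSpace.norm_sq_eq]
  unfold sampleDist
  set S : ℝ := (∑ i, |z₁.1.1 i - z₂.1.1 i| ^ p) + |(z₁.2 : ℝ) - (z₂.2 : ℝ)| ^ p with hS
  have hS0 : 0 ≤ S := by positivity
  have key : ∀ u : ℝ, 0 ≤ u → u ^ p ≤ S → u ^ 2 ≤ u ^ p * S ^ (2 / p - 1) := by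
    intro u hu huS
    rcases hu.eq_or_lt with rfl | hu'
    · rw [Real.zero_rpow hp0.ne']; simp
    · have h0 : (0 : ℝ) ≤ 2 / p - 1 := by rw [sub_nonneg, le_div_iff₀ hp0]; linarith
      calc u ^ 2 = u ^ p * (u ^ p) ^ (2 / p - 1) := by
            rw [← Real.rpow_mul hu, ← Real.rpow_add hu', ← Real.rpow_natCast]
            congr 1
            push_cast
            field_simp
            ring
        _ ≤ u ^ p * S ^ (2 / p - 1) := by gcongr
  have hle1 : ∀ i, |z₁.1.1 i - z₂.1.1 i| ^ p ≤ S := fun i => by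
    have := Finset.single_le_sum (f := fun i => |z₁.1.1 i - z₂.1.1 i| ^ p)
      (fun i _ => by positivity) (Finset.mem_univ i)
    have h2 : 0 ≤ |(z₁.2 : ℝ) - (z₂.2 : ℝ)| ^ p := by positivity
    simp only at this
    linarith
  have hle2 : |(z₁.2 : ℝ) - (z₂.2 : ℝ)| ^ p ≤ S := by
    have : 0 ≤ ∑ i, |z₁.1.1 i - z₂.1.1 i| ^ p := Finset.sum_nonneg fun i _ => by positivity
    linarith
  have hfin : (S ^ (1 / p)) ^ 2 = S * S ^ (2 / p - 1) := by
    rcases hS0.eq_or_lt with h | h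
    · rw [← h, Real.zero_rpow (by positivity)]; simp
    · rw [← Real.rpow_natCast, ← Real.rpow_mul h.le]
      nth_rewrite 2 [← Real.rpow_one S]
      rw [← Real.rpow_add h]
      congr 1
      push_cast
      ring
  rw [hfin]
  nth_rewrite 1 [hS]
  rw [add_mul, Finset.sum_mul]
  refine add_le_add (Finset.sum_le_sum fun i _ => ?_) (key _ (abs_nonneg _) hle2)
  exact key _ (abs_nonneg _) (hle1 i)

lemma abs_loss_sub_loss_le {ℓ : Label → Label → ℝ} {L R : ℝ} (hL : 0 ≤ L)
    (hℓ_fst : ∀ a a' y, |ℓ a y - ℓ a' y| ≤ L * |(a : ℝ) - (a' : ℝ)|)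
    (hℓ_snd : ∀ a y y', |ℓ a y - ℓ a y'| ≤ L * |(y : ℝ) - (y' : ℝ)|)
    {h : ↥X → Label} (hh : ∀ x x' : ↥X,
      |(h x : ℝ) - (h x' : ℝ)| ≤ R * ‖(x : EuclideanSpace ℝ (Fin d)) - x'‖)
    {p : ℝ} (hp1 : 1 ≤ p) (hp2 : p ≤ 2) (z₁ z₂ : Sample X) :
    |ℓ (h z₁.1) z₁.2 - ℓ (h z₂.1) z₂.2| ≤ L * √(R ^ 2 + 1) * sampleDist p z₁ z₂ := by
  set u := ‖(z₁.1 : EuclideanSpace ℝ (Fin d)) - z₂.1‖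
  set v := |(z₁.2 : ℝ) - z₂.2|
  have h1 : |ℓ (h z₁.1) z₁.2 - ℓ (h z₂.1) z₂.2| ≤ L * (R * u + v) :=
    calc _ ≤ |ℓ (h z₁.1) z₁.2 - ℓ (h z₂.1) z₁.2| + |ℓ (h z₂.1) z₁.2 - ℓ (h z₂.1) z₂.2| :=
          abs_sub_le _ _ _
      _ ≤ L * |(h z₁.1 : ℝ) - h z₂.1| + L * v := add_le_add (hℓ_fst _ _ _) (hℓ_snd _ _ _)
      _ ≤ L * (R * u) + L * v := by gcongr; exact hh _ _
      _ = L * (R * u + v) := by ring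
  have h2 : R * u + v ≤ √(R ^ 2 + 1) * √(u ^ 2 + v ^ 2) := by
    rw [← Real.sqrt_mul (by positivity)]
    refine Real.le_sqrt_of_sq_le ?_
    nlinarith [sq_nonneg (R * v - u)]
  calc _ ≤ L * (R * u + v) := h1
    _ ≤ L * (√(R ^ 2 + 1) * sampleDist p z₁ z₂) := by
        refine mul_le_mul_of_nonneg_left (h2.trans ?_) hL
        gcongr
        exact sqrt_le_sampleDist hp1 hp2 _ _
    _ = _ := by ring

lemma wassersteinDist_nonneg (p r : ℝ) (μ ν : Measure (Sample X)) :
    0 ≤ wassersteinDist p r μ ν := by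
  refine Real.sInf_nonneg ?_
  rintro _ ⟨π, -, rfl⟩
  exact Real.rpow_nonneg (integral_nonneg fun w => Real.rpow_nonneg (sampleDist_nonneg _ _ _) _) _

lemma isCoupling_prod {α : Type*} [MeasurableSpace α] (μ ν : Measure α) [IsProbabilityMeasure μ]
    [IsProbabilityMeasure ν] : IsCoupling μ ν (μ.prod ν) :=
  ⟨by simp, by simp⟩

/-- A bounded function whose increments are at most `K` times the `p`-distance has expectations
that differ by at most `K` times the Wasserstein distance, whatever its order. -/
lemma abs_integral_sub_integral_le_wassersteinDist [CompactSpace X] {p r : ℝ} (hp : 1 ≤ p)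
    (hr : 1 ≤ r) (μ ν : Measure (Sample X)) [IsProbabilityMeasure μ] [IsProbabilityMeasure ν]
    {f : Sample X → ℝ} (hf : Measurable f) {B : ℝ} (hB : ∀ z, |f z| ≤ B) {K : ℝ} (hK : 0 ≤ K)
    (hfK : ∀ z₁ z₂, |f z₁ - f z₂| ≤ K * sampleDist p z₁ z₂) :
    |∫ z, f z ∂μ - ∫ z, f z ∂ν| ≤ K * wassersteinDist p r μ ν := by
  have hr0 : 0 < r := by linarith
  have hcont := continuous_sampleDist (X := X) hp
  obtain ⟨C, hC⟩ := (isCompact_univ (X := Sample X × Sample X)).exists_bound_of_continuousOn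
    hcont.continuousOn
  have hcoup : ∀ π : Measure (Sample X × Sample X), IsCoupling μ ν π →
      |∫ z, f z ∂μ - ∫ z, f z ∂ν|
        ≤ K * (∫ w, sampleDist p w.1 w.2 ^ r ∂π) ^ (1 / r) := by
    rintro π ⟨h1, h2⟩
    have hπ : IsProbabilityMeasure π := by
      have : IsProbabilityMeasure (π.map Prod.fst) := by rw [h1]; infer_instance
      exact Measure.isProbabilityMeasure_of_map Prod.fst
    have hi : Integrable (fun w : Sample X × Sample X => sampleDist p w.1 w.2) π :=
      Integrable.of_bound hcont.measurable.aestronglyMeasurable C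
        (Filter.Eventually.of_forall fun w => hC w (Set.mem_univ _))
    have hir : Integrable (fun w : Sample X × Sample X => sampleDist p w.1 w.2 ^ r) π := by
      refine Integrable.of_bound (hcont.measurable.pow_const r).aestronglyMeasurable (C ^ r)
        (Filter.Eventually.of_forall fun w => ?_)
      have h := hC w (Set.mem_univ _)
      rw [Real.norm_of_nonneg (sampleDist_nonneg _ _ _)] at h
      rw [Real.norm_of_nonneg (Real.rpow_nonneg (sampleDist_nonneg _ _ _) _)]
      exact Real.rpow_le_rpow (sampleDist_nonneg _ _ _) h hr0.le
    have hJ : ∫ w, sampleDist p w.1 w.2 ∂π ≤ (∫ w, sampleDist p w.1 w.2 ^ r ∂π) ^ (1 / r) := by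
      have h0 : 0 ≤ ∫ w, sampleDist p w.1 w.2 ∂π := integral_nonneg fun w => sampleDist_nonneg _ _ _
      have := (convexOn_rpow hr).map_integral_le (μ := π)
        (f := fun w : Sample X × Sample X => sampleDist p w.1 w.2)
        (Real.continuous_rpow_const hr0.le).continuousOn isClosed_Ici
        (Filter.Eventually.of_forall fun w => sampleDist_nonneg _ _ _) hi hir
      calc ∫ w, sampleDist p w.1 w.2 ∂π = ((∫ w, sampleDist p w.1 w.2 ∂π) ^ r) ^ (1 / r) := by
            rw [← Real.rpow_mul h0, mul_one_div_cancel hr0.ne', Real.rpow_one]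
        _ ≤ _ := Real.rpow_le_rpow (Real.rpow_nonneg h0 _) this (by positivity)
    have hf1 : Integrable (fun w : Sample X × Sample X => f w.1) π :=
      integrable_of_abs_le (hf.comp measurable_fst) fun w => hB _
    have hf2 : Integrable (fun w : Sample X × Sample X => f w.2) π :=
      integrable_of_abs_le (hf.comp measurable_snd) fun w => hB _
    rw [← h1, ← h2, integral_map measurable_fst.aemeasurable hf.aestronglyMeasurable,
      integral_map measurable_snd.aemeasurable hf.aestronglyMeasurable, ← integral_sub hf1 hf2]
    calc |∫ w, (f w.1 - f w.2) ∂π| ≤ ∫ w, |f w.1 - f w.2| ∂π := abs_integral_le_integral_abs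
      _ ≤ ∫ w, K * sampleDist p w.1 w.2 ∂π :=
          integral_mono (hf1.sub hf2).abs (hi.const_mul K) fun w => hfK _ _
      _ = K * ∫ w, sampleDist p w.1 w.2 ∂π := integral_const_mul _ _
      _ ≤ _ := by gcongr
  rcases hK.eq_or_lt with rfl | hK'
  · simpa using hcoup _ (isCoupling_prod μ ν)
  · rw [← div_le_iff₀' hK']
    refine le_csInf ⟨_, _, isCoupling_prod μ ν, rfl⟩ ?_
    rintro _ ⟨π, hπ, rfl⟩
    rw [div_le_iff₀' hK']
    exact hcoup π hπ

end Wasserstein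

/-! ### Concentration of the uniform deviation -/

section Concentration

variable {ι 𝒵 : Type*} {F : ι → 𝒵 → ℝ} {B : ℝ} {n : ℕ}

lemma abs_average_update_sub_le {f : 𝒵 → ℝ} (hB : ∀ z, |f z| ≤ B) (z : Fin n → 𝒵) (i : Fin n)
    (a : 𝒵) :
    |(1 / (n : ℝ)) * ∑ j, f (Function.update z i a j) - (1 / (n : ℝ)) * ∑ j, f (z j)|
      ≤ 2 * B / n := by
  rw [← mul_sub, ← Finset.sum_sub_distrib, Finset.sum_eq_single i
    (fun j _ hj => by rw [Function.update_of_ne hj, sub_self]) (by simp), Function.update_self,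
    abs_mul, abs_of_nonneg (by positivity : (0 : ℝ) ≤ 1 / n), one_div, inv_mul_eq_div]
  gcongr
  exact (abs_sub _ _).trans (by linarith [hB a, hB (z i)])

variable [MeasurableSpace 𝒵] {μ : Measure 𝒵} [Finite ι] [Nonempty ι]

lemma abs_supDeviation_update_sub_le (hB : ∀ i z, |F i z| ≤ B) (z : Fin n → 𝒵) (j : Fin n)
    (a : 𝒵) : |supDeviation μ F (Function.update z j a) - supDeviation μ F z| ≤ 2 * B / n := by
  refine abs_iSup_sub_iSup_le fun i => ?_
  rw [sub_sub_sub_cancel_left, abs_sub_comm]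
  exact abs_average_update_sub_le (hB i) z j a

variable [IsProbabilityMeasure μ]

lemma hasSubgaussianMGF_supDeviation (hF : ∀ i, Measurable (F i)) (hB : ∀ i z, |F i z| ≤ B)
    (hB0 : 0 ≤ B) (hn : 1 ≤ n) :
    HasSubgaussianMGF (fun z : Fin n → 𝒵 => supDeviation μ F z
        - ∫ z : Fin n → 𝒵, supDeviation μ F z ∂Measure.pi fun _ => μ)
      (B ^ 2 / n).toNNReal (Measure.pi fun _ => μ) := by
  have h := hasSubgaussianMGF_of_bounded_differences μ (n := n) (measurable_supDeviation hF)
    (abs_supDeviation_le hB hB0) (abs_supDeviation_update_sub_le (μ := μ) hB)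
  have hn' : (n : ℝ) ≠ 0 := by positivity
  convert h using 2
  field_simp

/-- The deviation of the class and the empirical average of one fixed member together have twice
the oscillation of the deviation alone. -/
lemma hasSubgaussianMGF_supDeviation_add_average (hF : ∀ i, Measurable (F i))
    (hB : ∀ i z, |F i z| ≤ B) (hB0 : 0 ≤ B) (hn : 1 ≤ n) (i : ι) :
    HasSubgaussianMGF (fun z : Fin n → 𝒵 => supDeviation μ F z + (1 / (n : ℝ)) * ∑ j, F i (z j)
        - (∫ z : Fin n → 𝒵, supDeviation μ F z ∂(Measure.pi fun _ => μ) + ∫ x, F i x ∂μ))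
      ((2 * B) ^ 2 / n).toNNReal (Measure.pi fun _ => μ) := by
  have havg : Measurable fun z : Fin n → 𝒵 => (1 / (n : ℝ)) * ∑ j, F i (z j) :=
    Measurable.const_mul (Finset.measurable_sum _ fun j _ =>
      (hF i).comp (measurable_pi_apply j)) _
  have h := hasSubgaussianMGF_of_bounded_differences μ (n := n) (c := 2 * (2 * B / n))
    (M := 2 * B + B)
    (f := fun z => supDeviation μ F z + (1 / (n : ℝ)) * ∑ j, F i (z j))
    ((measurable_supDeviation hF).add havg)
    (fun z => (abs_add_le _ _).trans (add_le_add (abs_supDeviation_le hB hB0 z)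
      (abs_average_le hB0 fun j => hB i _)))
    (fun z j a => by
      rw [add_sub_add_comm, two_mul (2 * B / n)]
      exact (abs_add_le _ _).trans (add_le_add (abs_supDeviation_update_sub_le hB z j a)
        (abs_average_update_sub_le (hB i) z j a)))
  rw [integral_add (integrable_of_abs_le (measurable_supDeviation hF) (abs_supDeviation_le hB hB0))
    (integrable_of_abs_le havg fun z => abs_average_le hB0 fun j => hB i _),
    integral_pi_average (hF i) (hB i) hn] at h
  have hn' : (n : ℝ) ≠ 0 := by positivity
  convert h using 2
  field_simp

end Concentration

/-- A sub-Gaussian variable is below its Chernoff bound on a measurable event. -/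
lemma exists_measurableSet_le_of_hasSubgaussianMGF {Ω : Type*} [MeasurableSpace Ω] {P : Measure Ω}
    [IsProbabilityMeasure P] {Y : Ω → ℝ} {c : NNReal} (hY : HasSubgaussianMGF Y c P) (hc : 0 < c)
    {δ : ℝ} (hδ0 : 0 < δ) (hδ1 : δ < 1) :
    ∃ G : Set Ω, MeasurableSet G ∧ 1 - δ ≤ P.real G ∧
      ∀ ω ∈ G, Y ω ≤ √c * (√2 * √(Real.log (1 / δ))) := by
  have hlog : 0 ≤ Real.log (1 / δ) := Real.log_nonneg (by rw [le_div_iff₀ hδ0]; linarith)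
  set ε := √c * (√2 * √(Real.log (1 / δ))) with hε
  have hε0 : 0 ≤ ε := by positivity
  have htail : P.real {ω | ε ≤ Y ω} ≤ δ := by
    refine (hY.measure_ge_le hε0).trans (le_of_eq ?_)
    have hc' : (0 : ℝ) < c := hc
    have : -ε ^ 2 / (2 * c) = Real.log δ := by
      rw [hε, mul_pow, mul_pow, Real.sq_sqrt c.coe_nonneg, Real.sq_sqrt zero_le_two,
        Real.sq_sqrt hlog, one_div, Real.log_inv]
      field_simp
    rw [this, Real.exp_log hδ0]
  refine ⟨(toMeasurable P {ω | ε ≤ Y ω})ᶜ, (measurableSet_toMeasurable _ _).compl, ?_, ?_⟩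
  · rw [probReal_compl_eq_one_sub (measurableSet_toMeasurable _ _)]
    have : P.real (toMeasurable P {ω | ε ≤ Y ω}) = P.real {ω | ε ≤ Y ω} := by
      simp [Measure.real, measure_toMeasurable]
    rw [this]
    linarith
  · intro ω hω
    by_contra! hlt
    exact hω (subset_toMeasurable _ _ hlt.le)

/-! ### Generalisation bounds for the loss class -/

section Risk

lemma lossClass_eq_range {𝒳 : Type*} (ℓ : Label → Label → ℝ) (H : Set (𝒳 → Label)) :
    lossClass ℓ H = Set.range fun (h : H) (z : 𝒳 × Label) => ℓ (h.1 z.1) z.2 :=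
  Set.image_eq_range _ _

variable {𝒳 : Type*} [MeasurableSpace 𝒳] {H : Set (𝒳 → Label)} {ℓ : Label → Label → ℝ} {B : ℝ}

/-- The loss class inherits the Rademacher complexity of the classifiers, up to any bound `c` for
the slope of the loss. -/
lemma rademacher_lossClass_le [Finite H] [Nonempty H] (hH : ∀ h ∈ H, Measurable h) {n : ℕ}
    {μ : Measure (𝒳 × Label)} [IsProbabilityMeasure μ] (hB : ∀ a y, |ℓ a y| ≤ B) {u v : Label → ℝ}
    {c : ℝ} (hc : 0 ≤ c) (hv : ∀ y, |v y| ≤ c) (huv : ∀ a y, ℓ a y = u y + v y * (a : ℝ)) :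
    rademacher n μ (lossClass ℓ H) ≤ c * rademacher n (μ.map Prod.fst) (realClass H) := by
  rw [lossClass_eq_range, show realClass H = Set.range fun (h : H) (x : 𝒳) => (h.1 x : ℝ) from
    Set.image_eq_range _ _]
  exact rademacher_affine_le (M := max B 1) measurable_fst (fun h => measurable_loss ℓ (hH _ h.2))
    (fun h => measurable_subtype_coe.comp (hH _ h.2)) (fun h z => (hB _ _).trans (le_max_left _ _))
    (fun h z => (Label.abs_coe _).le.trans (le_max_right _ _)) (le_max_of_le_right zero_le_one)
    hc (a := fun z => v z.2) (b := fun z => u z.2) (fun z => hv _) fun h z => huv _ _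

lemma risk_le_empRisk_add_supDeviation [Finite H] {D : Measure (𝒳 × Label)} {n : ℕ}
    (S : Fin n → 𝒳 × Label) {h : 𝒳 → Label} (hh : h ∈ H) :
    risk ℓ D h ≤ empRisk ℓ S h
      + supDeviation D (fun (h : H) (z : 𝒳 × Label) => ℓ (h.1 z.1) z.2) S := by
  have := le_supDeviation (μ := D) (F := fun (h : H) (z : 𝒳 × Label) => ℓ (h.1 z.1) z.2)
    ⟨h, hh⟩ S
  unfold risk empRisk
  linarith

variable {Ω : Type*} [MeasurableSpace Ω] {P : Measure Ω} [IsProbabilityMeasure P]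

/-- The uniform one-sided generalisation bound over one sample. -/
lemma exists_risk_le_empRisk_add [Finite H] [Nonempty H] (hH : ∀ h ∈ H, Measurable h)
    (hB : ∀ a y, |ℓ a y| ≤ B) (hB0 : 0 < B) {D : Measure (𝒳 × Label)} [IsProbabilityMeasure D]
    {n : ℕ} (hn : 1 ≤ n) {Z : Fin n → Ω → 𝒳 × Label}
    (hZ : HasLaw (fun ω j => Z j ω) (Measure.pi fun _ => D) P)
    {δ : ℝ} (hδ0 : 0 < δ) (hδ1 : δ < 1) :
    ∃ G : Set Ω, MeasurableSet G ∧ 1 - δ ≤ P.real G ∧ ∀ ω ∈ G, ∀ h ∈ H,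
      risk ℓ D h ≤ empRisk ℓ (fun j => Z j ω) h + 2 * rademacher n D (lossClass ℓ H)
        + √2 * B * √(Real.log (1 / δ)) * (1 / √n) := by
  set F : H → 𝒳 × Label → ℝ := fun h z => ℓ (h.1 z.1) z.2
  have hF : ∀ h, Measurable (F h) := fun h => measurable_loss ℓ (hH _ h.2)
  have hFB : ∀ h z, |F h z| ≤ B := fun h z => hB _ _
  have hsub := hasSubgaussianMGF_supDeviation (μ := D) hF hFB hB0.le hn
  rw [← hZ.map_eq] at hsub
  obtain ⟨G, hGm, hGP, hG⟩ := exists_measurableSet_le_of_hasSubgaussianMGF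
    (HasSubgaussianMGF.of_map hZ.aemeasurable hsub) (by rw [Real.toNNReal_pos]; positivity) hδ0 hδ1
  refine ⟨G, hGm, hGP, fun ω hω h hh => ?_⟩
  have h1 := hG ω hω
  have h2 := integral_supDeviation_le (μ := D) hF hFB hn
  have h3 := risk_le_empRisk_add_supDeviation (ℓ := ℓ) (D := D) (fun j => Z j ω) hh
  rw [hZ.map_eq, Real.coe_toNNReal _ (by positivity), Real.sqrt_div (by positivity),
    Real.sqrt_sq hB0.le] at h1
  rw [lossClass_eq_range]
  have h4 : B / √n * (√2 * √(Real.log (1 / δ))) = √2 * B * √(Real.log (1 / δ)) * (1 / √n) := by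
    ring
  simp only [Function.comp_apply] at h1
  linarith

/-- The risk of an empirical risk minimiser for a second domain is controlled by the empirical risk
on a first domain. The two samples may depend on each other: their deviations are combined through
the sub-Gaussian norm, which costs no union bound. -/
lemma exists_risk_erm_le_empRisk_add [Finite H] [Nonempty H] (hH : ∀ h ∈ H, Measurable h)
    (hB : ∀ a y, |ℓ a y| ≤ B) (hB0 : 0 < B) {D₁ D₂ : Measure (𝒳 × Label)}
    [IsProbabilityMeasure D₁] [IsProbabilityMeasure D₂] {Δ : ℝ}
    (hΔ : ∀ h ∈ H, risk ℓ D₂ h ≤ risk ℓ D₁ h + Δ)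
    {n₁ n₂ : ℕ} (hn₁ : 1 ≤ n₁) (hn₂ : 1 ≤ n₂)
    {Z₁ : Fin n₁ → Ω → 𝒳 × Label} {Z₂ : Fin n₂ → Ω → 𝒳 × Label}
    (hZ₁ : HasLaw (fun ω j => Z₁ j ω) (Measure.pi fun _ => D₁) P)
    (hZ₂ : HasLaw (fun ω j => Z₂ j ω) (Measure.pi fun _ => D₂) P)
    {δ : ℝ} (hδ0 : 0 < δ) (hδ1 : δ < 1) :
    ∃ G : Set Ω, MeasurableSet G ∧ 1 - δ ≤ P.real G ∧ ∀ ω ∈ G, ∀ h₁ ∈ H, ∀ h₂,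
      IsERM ℓ H (fun j => Z₂ j ω) h₂ →
      risk ℓ D₂ h₂ ≤ empRisk ℓ (fun j => Z₁ j ω) h₁ + Δ
        + 2 * rademacher n₁ D₁ (lossClass ℓ H) + 2 * rademacher n₂ D₂ (lossClass ℓ H)
        + √2 * B * √(Real.log (1 / δ)) * (1 / √n₁ + 2 * (1 / √n₂)) := by
  set F : H → 𝒳 × Label → ℝ := fun h z => ℓ (h.1 z.1) z.2
  have hF : ∀ h, Measurable (F h) := fun h => measurable_loss ℓ (hH _ h.2)
  have hFB : ∀ h z, |F h z| ≤ B := fun h z => hB _ _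
  -- The comparison classifier is a minimiser of the true risk, so it does not depend on the samples.
  obtain ⟨g, hg⟩ := Finite.exists_min fun h : H => risk ℓ D₂ h.1
  have hsub₁ := hasSubgaussianMGF_supDeviation (μ := D₁) hF hFB hB0.le hn₁
  have hsub₂ := hasSubgaussianMGF_supDeviation_add_average (μ := D₂) hF hFB hB0.le hn₂ g
  rw [← hZ₁.map_eq] at hsub₁
  rw [← hZ₂.map_eq] at hsub₂
  obtain ⟨G, hGm, hGP, hG⟩ := exists_measurableSet_le_of_hasSubgaussianMGF
    ((HasSubgaussianMGF.of_map hZ₁.aemeasurable hsub₁).add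
      (HasSubgaussianMGF.of_map hZ₂.aemeasurable hsub₂)) (by
        have : 0 < (B ^ 2 / n₁).toNNReal := by rw [Real.toNNReal_pos]; positivity
        have := NNReal.sqrt_pos.2 this
        positivity) hδ0 hδ1
  refine ⟨G, hGm, hGP, fun ω hω h₁ hh₁ h₂ hh₂ => ?_⟩
  have e1 := hG ω hω
  have e2 := integral_supDeviation_le (μ := D₁) hF hFB hn₁
  have e3 := integral_supDeviation_le (μ := D₂) hF hFB hn₂
  have e4 := risk_le_empRisk_add_supDeviation (ℓ := ℓ) (D := D₁) (fun j => Z₁ j ω) hh₁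
  have e5 := risk_le_empRisk_add_supDeviation (ℓ := ℓ) (D := D₂) (fun j => Z₂ j ω) hh₂.1
  have e6 := hh₂.2 g.1 g.2
  have e7 := hg ⟨h₁, hh₁⟩
  have e8 := hΔ h₁ hh₁
  rw [hZ₁.map_eq, hZ₂.map_eq] at e1
  simp only [Function.comp_apply, NNReal.coe_pow, NNReal.coe_add, Real.coe_sqrt] at e1
  rw [Real.sqrt_sq (by positivity), Real.coe_toNNReal _ (by positivity),
    Real.coe_toNNReal _ (by positivity), Real.sqrt_div (by positivity),
    Real.sqrt_div (by positivity), Real.sqrt_sq hB0.le, Real.sqrt_sq (by positivity)] at e1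
  rw [lossClass_eq_range]
  have h4 : (B / √n₁ + 2 * B / √n₂) * (√2 * √(Real.log (1 / δ)))
      = √2 * B * √(Real.log (1 / δ)) * (1 / √n₁ + 2 * (1 / √n₂)) := by
    ring
  rw [h4] at e1
  change _ + ((supDeviation D₂ F fun j => Z₂ j ω) + empRisk ℓ (fun j => Z₂ j ω) g.1
    - (_ + risk ℓ D₂ g.1)) ≤ _ at e1
  simp only at e7
  linarith

end Risk

/-! ### Gradual fine-tuning along a path of domains -/

lemma hasLaw_pi_of_iIndepFun {Ω 𝒵 : Type*} [MeasurableSpace Ω] [MeasurableSpace 𝒵] {P : Measure Ω}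
    [IsProbabilityMeasure P] {μ : Measure 𝒵} {n : ℕ} {Z : Fin n → Ω → 𝒵}
    (hlaw : ∀ i, HasLaw (Z i) μ P) (hind : iIndepFun Z P) :
    HasLaw (fun ω j => Z j ω) (Measure.pi fun _ => μ) P where
  aemeasurable := aemeasurable_pi_lambda _ fun i => (hlaw i).aemeasurable
  map_eq := by
    rw [(iIndepFun_iff_map_fun_eq_pi_map fun i => (hlaw i).aemeasurable).1 hind]
    congr 1
    exact funext fun i => (hlaw i).map_eq

lemma seqRademacher_lossClass_nonneg {𝒳 : Type*} [Nonempty 𝒳] {H : Set (𝒳 → Label)} [Finite H]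
    [Nonempty H] {ℓ : Label → Label → ℝ} {B : ℝ} (hB : ∀ a y, |ℓ a y| ≤ B) (hB0 : 0 ≤ B) (N : ℕ) :
    0 ≤ seqRademacher N (lossClass ℓ H) := by
  rw [lossClass_eq_range]
  exact (empRademacher_nonneg _ fun _ => (Classical.arbitrary 𝒳, ⟨1, by simp⟩)).trans
    (empRademacher_le_seqRademacher (fun h z => hB _ _) hB0 _)

/-- For one domain, the Rademacher hypothesis pays for the uniform deviation when the loss is small
and the sequential Rademacher complexity does so when the loss is large. -/
lemma two_mul_rademacher_le {B ρ s : ℝ} {N : ℕ} (hN : 2 ≤ N) (hB : 0 ≤ B) (hs0 : 0 ≤ s)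
    (hs : ρ ≤ s) (hρ : ρ ≤ B * (B / √N)) :
    2 * ρ ≤ 6 * B * √(4 * Real.pi * Real.log N) * s + 1 / √N := by
  have hN0 : (0 : ℝ) < √N := Real.sqrt_pos.2 (by positivity)
  by_cases hB2 : 2 * B ^ 2 ≤ 1
  · have h1 : 2 * ρ ≤ 1 / √N := by
      calc 2 * ρ ≤ 2 * (B * (B / √N)) := by linarith
        _ = 2 * B ^ 2 / √N := by ring
        _ ≤ 1 / √N := by gcongr
    have h2 : 0 ≤ 6 * B * √(4 * Real.pi * Real.log N) * s := by positivity
    linarith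
  · have hlog : (1 / 2 : ℝ) ≤ Real.log N := by
      have : Real.log 2 ≤ Real.log N := Real.log_le_log two_pos (by exact_mod_cast hN)
      linarith [Real.log_two_gt_d9]
    have hsq : 2 ≤ √(4 * Real.pi * Real.log N) := by
      refine Real.le_sqrt_of_sq_le ?_
      nlinarith [Real.pi_gt_three]
    have hB' : 1 / 2 ≤ B := by
      push Not at hB2
      nlinarith
    have h1 : 2 ≤ 6 * B * √(4 * Real.pi * Real.log N) := by nlinarith
    have h2 : 2 * ρ ≤ 6 * B * √(4 * Real.pi * Real.log N) * s := by
      calc 2 * ρ ≤ 2 * s := by linarith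
        _ ≤ _ := by gcongr
    have h3 : 0 ≤ 1 / √(N : ℝ) := by positivity
    linarith

/-- The numerical comparison for a path of `k ≥ 2` domains; `s₁` and `s₂` are the inverse square
roots of the first and of the last sample size, `Λ = √(log (1/δ))`. -/
lemma deviation_le_of_two_le {L B Λ k s₁ s₂ S Q : ℝ} (hL : 0 ≤ L) (hB : 0 ≤ B) (hΛ : 0 ≤ Λ)
    (hk : 2 ≤ k) (h₁ : 0 ≤ s₁) (h₂ : 0 ≤ s₂) (hS : s₁ + s₂ ≤ S) (hQ : s₂ ≤ Q) :
    2 * (L * (B * s₁)) + 2 * (L * (B * s₂)) + √2 * B * Λ * (s₁ + 2 * s₂)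
      ≤ (4 * √2 * L * B + 2 * √2 * B * Λ) * (k - 1) / k * S + (B * (2 * √2 * Λ) + 1) / k * Q := by
  have hk0 : 0 < k := by linarith
  set q := 1 / k with hq
  have hq0 : 0 < q := by positivity
  have hq1 : q ≤ 1 / 2 := by rw [hq]; exact one_div_le_one_div_of_le two_pos hk
  have e1 : (k - 1) / k = 1 - q := by rw [hq]; field_simp
  rw [mul_div_assoc, e1, div_eq_mul_one_div (B * (2 * √2 * Λ) + 1) k, ← hq]
  have hw1 : 1 ≤ √2 := Real.one_le_sqrt.2 one_le_two
  have step1 : (4 * √2 * L * B + 2 * √2 * B * Λ) * (1 - q) * (s₁ + s₂)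
      ≤ (4 * √2 * L * B + 2 * √2 * B * Λ) * (1 - q) * S := by
    have : 0 ≤ 1 - q := by linarith
    gcongr
  have step2 : (B * (2 * √2 * Λ)) * q * s₂ ≤ (B * (2 * √2 * Λ) + 1) * q * Q := by
    gcongr
    linarith
  have step3 : 2 * (L * B) * (s₁ + s₂) ≤ 4 * √2 * L * B * (1 - q) * (s₁ + s₂) := by
    have : 2 ≤ 4 * √2 * (1 - q) := by nlinarith
    calc 2 * (L * B) * (s₁ + s₂) ≤ (4 * √2 * (1 - q)) * (L * B) * (s₁ + s₂) := by gcongr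
      _ = _ := by ring
  have step4 : √2 * B * Λ * s₁ ≤ 2 * √2 * B * Λ * (1 - q) * s₁ := by
    have : 1 ≤ 2 * (1 - q) := by linarith
    calc √2 * B * Λ * s₁ = 1 * (√2 * B * Λ * s₁) := by ring
      _ ≤ 2 * (1 - q) * (√2 * B * Λ * s₁) := by gcongr
      _ = _ := by ring
  linarith

end GFT

theorem theorem1
    {d : ℕ} (X : Set (EuclideanSpace ℝ (Fin d)))
    (hXcompact : IsCompact X) (hXball : ∀ x ∈ X, ‖x‖ ≤ 1)
    -- hypothesis class and loss function
    (H : Set (↥X → GFT.Label)) (ℓ : GFT.Label → GFT.Label → ℝ)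
    (L R B : ℝ) (hL : 0 ≤ L) (hR : 0 ≤ R)
    (hH : ∀ h ∈ H, ∀ x x' : ↥X,
      |(h x : ℝ) - (h x' : ℝ)| ≤ R * ‖(x : EuclideanSpace ℝ (Fin d)) - x'‖)
    (hℓ_bdd : ∀ a y, |ℓ a y| ≤ B)
    (hℓ_fst : ∀ a a' y, |ℓ a y - ℓ a' y| ≤ L * |(a : ℝ) - (a' : ℝ)|)
    (hℓ_snd : ∀ a y y', |ℓ a y - ℓ a y'| ≤ L * |(y : ℝ) - (y' : ℝ)|)
    -- the Wasserstein distance: exponent of the norm, and order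
    (p r : ℝ) (hp1 : 1 ≤ p) (hp2 : p ≤ 2) (hr : 1 ≤ r)
    -- source domains `D 1, …, D κ` in the order of the path, and the target domain
    (κ : ℕ) (hκ : 1 ≤ κ)
    (D : ℕ → ProbabilityMeasure (GFT.Sample X)) (D_T : ProbabilityMeasure (GFT.Sample X))
    -- sample sizes
    (n : ℕ → ℕ) (hn : ∀ t ∈ Finset.Icc 1 κ, 1 ≤ n t)
    (hn_total : 2 ≤ ∑ t ∈ Finset.Icc 1 κ, n t)
    (hRad : ∀ t ∈ Finset.Icc 1 κ,
      GFT.rademacher (n t) ((D t : Measure (GFT.Sample X)).map Prod.fst) (GFT.realClass H)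
        ≤ B / √(n t : ℝ))
    -- the data sets: `n t` independent draws from `D t`
    {Ω : Type*} [MeasurableSpace Ω] (P : Measure Ω) [IsProbabilityMeasure P]
    (Z : (t : ℕ) → Fin (n t) → Ω → GFT.Sample X)
    (hZ_law : ∀ t ∈ Finset.Icc 1 κ, ∀ i,
      HasLaw (Z t i) (D t : Measure (GFT.Sample X)) P)
    (hZ_indep : ∀ t ∈ Finset.Icc 1 κ, iIndepFun (Z t) P)
    -- gradual fine-tuning: the stage-`t` classifier minimises the empirical risk on data set `t`
    (h_hat : ℕ → Ω → ↥X → GFT.Label)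
    (hERM : ∀ t ∈ Finset.Icc 1 κ, ∀ ω, GFT.IsERM ℓ H (fun i => Z t i ω) (h_hat t ω))
    (δ : ℝ) (hδ0 : 0 < δ) (hδ1 : δ < 1) :
    ∃ G : Set Ω, MeasurableSet G ∧ 1 - δ ≤ P.real G ∧ ∀ ω ∈ G,
      GFT.risk ℓ (D_T : Measure (GFT.Sample X)) (h_hat κ ω) ≤
        L * √(R ^ 2 + 1) * GFT.wassersteinDist p r (D_T : Measure (GFT.Sample X)) (D κ)
        + GFT.empRisk ℓ (fun i => Z 1 i ω) (h_hat 1 ω)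
        + (1 + 1 / (κ : ℝ)) * (L * √(R ^ 2 + 1)) *
            ∑ t ∈ Finset.Icc 1 (κ - 1), GFT.wassersteinDist p r (D t : Measure (GFT.Sample X)) (D (t + 1))
        + (4 * √2 * L * B + 2 * √2 * B * √(Real.log (1 / δ))) * ((κ : ℝ) - 1) / κ *
            ∑ t ∈ Finset.range κ, 1 / √(n (t + 1) : ℝ)
        + 6 * B * √(4 * Real.pi * Real.log (∑ t ∈ Finset.Icc 1 κ, (n t : ℝ))) *
            GFT.seqRademacher (∑ t ∈ Finset.Icc 1 κ, n t) (GFT.lossClass ℓ H)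
        + (B * √(8 * Real.log (1 / δ)) + 1) / κ *
            √(∑ t ∈ Finset.Icc 1 κ, 1 / (n t : ℝ)) := by
  open GFT in
  -- The class is finite and nonempty, and its members are measurable.
  have : CompactSpace X := isCompact_iff_compactSpace.1 hXcompact
  have hHdist : ∀ h ∈ H, ∀ x x' : ↥X, |(h x : ℝ) - (h x' : ℝ)| ≤ R * dist x x' :=
    fun h hh x x' => by rw [Subtype.dist_eq, dist_eq_norm]; exact hH h hh x x'
  have hfin : Finite H := (finite_of_lipschitz hR hHdist).to_subtype
  obtain ⟨ω₀⟩ := nonempty_of_isProbabilityMeasure P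
  have h1κ : 1 ∈ Finset.Icc 1 κ := Finset.mem_Icc.2 ⟨le_rfl, hκ⟩
  have hκκ : κ ∈ Finset.Icc 1 κ := Finset.mem_Icc.2 ⟨hκ, le_rfl⟩
  have hne : Nonempty H := ⟨⟨_, (hERM 1 h1κ ω₀).1⟩⟩
  have hX : Nonempty X := (nonempty_of_isProbabilityMeasure (D 1 : Measure (Sample X))).map Prod.fst
  have hmeas : ∀ h ∈ H, Measurable h := fun h hh => measurable_of_lipschitz hR (hHdist h hh)
  have hB0 : 0 ≤ B := (abs_nonneg _).trans (hℓ_bdd ⟨1, by simp⟩ ⟨1, by simp⟩)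
  set K := L * √(R ^ 2 + 1) with hK
  have hK0 : 0 ≤ K := by positivity
  set W : ℕ → ℝ := fun t =>
    wassersteinDist p r (D t : Measure (Sample X)) (D (t + 1) : Measure (Sample X)) with hW
  have hW0 : ∀ t, 0 ≤ W t := fun t => wassersteinDist_nonneg _ _ _ _
  have htransfer : ∀ (μ ν : Measure (Sample X)) [IsProbabilityMeasure μ] [IsProbabilityMeasure ν],
      ∀ h ∈ H, |risk ℓ μ h - risk ℓ ν h| ≤ K * wassersteinDist p r μ ν :=
    fun μ ν _ _ h hh => abs_integral_sub_integral_le_wassersteinDist hp1 hr μ ν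
      (measurable_loss ℓ (hmeas h hh)) (fun z => hℓ_bdd _ _) hK0
      fun z₁ z₂ => abs_loss_sub_loss_le hL hℓ_fst hℓ_snd (hH h hh) hp1 hp2 z₁ z₂
  have hpath : ∀ h ∈ H, ∀ m : ℕ, risk ℓ (D (m + 1) : Measure (Sample X)) h
      ≤ risk ℓ (D 1 : Measure (Sample X)) h + K * ∑ t ∈ Finset.Icc 1 m, W t := by
    intro h hh m
    induction m with
    | zero => simp
    | succ m ih =>
      rw [Finset.sum_Icc_succ_top (by omega), mul_add]
      have := (abs_le.1 (htransfer (D (m + 1)) (D (m + 1 + 1)) h hh)).1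
      simp only [hW] at ih ⊢
      linarith
  have htarget : ∀ h ∈ H, risk ℓ (D_T : Measure (Sample X)) h
      ≤ risk ℓ (D κ : Measure (Sample X)) h
        + K * wassersteinDist p r (D_T : Measure (Sample X)) (D κ : Measure (Sample X)) :=
    fun h hh => by linarith [(abs_le.1 (htransfer D_T (D κ) h hh)).2]
  have hlaw : ∀ t ∈ Finset.Icc 1 κ,
      HasLaw (fun ω j => Z t j ω) (Measure.pi fun _ => (D t : Measure (Sample X))) P :=
    fun t ht => hasLaw_pi_of_iIndepFun (hZ_law t ht) (hZ_indep t ht)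
  obtain ⟨u, v, hvL, hvB, huv⟩ := exists_loss_eq_affine hℓ_bdd hℓ_fst
  have hradL : ∀ t ∈ Finset.Icc 1 κ,
      rademacher (n t) (D t : Measure (Sample X)) (lossClass ℓ H) ≤ L * (B / √(n t : ℝ)) :=
    fun t ht => (rademacher_lossClass_le hmeas hℓ_bdd hL hvL huv).trans
      (mul_le_mul_of_nonneg_left (hRad t ht) hL)
  have hradB : ∀ t ∈ Finset.Icc 1 κ,
      rademacher (n t) (D t : Measure (Sample X)) (lossClass ℓ H) ≤ B * (B / √(n t : ℝ)) :=
    fun t ht => (rademacher_lossClass_le hmeas hℓ_bdd hB0 hvB huv).trans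
      (mul_le_mul_of_nonneg_left (hRad t ht) hB0)
  have hseq := seqRademacher_lossClass_nonneg (H := H) hℓ_bdd hB0 (∑ t ∈ Finset.Icc 1 κ, n t)
  have hΛ : 0 ≤ √(Real.log (1 / δ)) := Real.sqrt_nonneg _
  have hsqrt8 : √(8 * Real.log (1 / δ)) = 2 * √2 * √(Real.log (1 / δ)) := by
    rw [Real.sqrt_mul (by norm_num), show (8 : ℝ) = 2 ^ 2 * 2 by norm_num,
      Real.sqrt_mul (by norm_num), Real.sqrt_sq zero_le_two]
  have hκ1 : (1 : ℝ) ≤ κ := by exact_mod_cast hκ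
  have hseqterm : 0 ≤ 6 * B * √(4 * Real.pi * Real.log (∑ t ∈ Finset.Icc 1 κ, (n t : ℝ))) *
      seqRademacher (∑ t ∈ Finset.Icc 1 κ, n t) (lossClass ℓ H) := by positivity
  have hWsum : 0 ≤ ∑ t ∈ Finset.Icc 1 (κ - 1), W t := Finset.sum_nonneg fun t _ => hW0 t
  have hWT : 0 ≤ wassersteinDist p r (D_T : Measure (Sample X)) (D κ : Measure (Sample X)) :=
    wassersteinDist_nonneg _ _ _ _
  rcases hB0.eq_or_lt with hB | hB
  · -- The loss vanishes identically.
    have hℓ0 : ∀ a y, ℓ a y = 0 := fun a y => abs_nonpos_iff.1 ((hℓ_bdd a y).trans hB.ge)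
    refine ⟨Set.univ, MeasurableSet.univ, by simp [hδ0.le], fun ω _ => ?_⟩
    have e1 : ∀ (μ : Measure (Sample X)) (h : ↥X → Label), risk ℓ μ h = 0 := fun μ h => by
      simp [risk, hℓ0]
    have e2 : empRisk ℓ (fun i => Z 1 i ω) (h_hat 1 ω) = 0 := by simp [empRisk, hℓ0]
    rw [e1, e2, ← hB]
    simp only [mul_zero, zero_mul, zero_div, add_zero, zero_add]
    positivity
  obtain ⟨m, rfl⟩ : ∃ m, κ = m + 1 := ⟨κ - 1, by omega⟩
  rcases Nat.eq_zero_or_pos m with rfl | hm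
  · obtain ⟨G, hGm, hGP, hG⟩ := exists_risk_le_empRisk_add hmeas hℓ_bdd hB (hn 1 h1κ)
      (hlaw 1 h1κ) hδ0 hδ1
    refine ⟨G, hGm, hGP, fun ω hω => ?_⟩
    have hmem := (hERM 1 h1κ ω).1
    have e1 := hG ω hω _ hmem
    have e2 := htarget _ hmem
    have e3 : rademacher (n 1) (D 1 : Measure (Sample X)) (lossClass ℓ H)
        ≤ seqRademacher (n 1) (lossClass ℓ H) := by
      rw [lossClass_eq_range]
      exact rademacher_le_seqRademacher (fun h => measurable_loss ℓ (hmeas _ h.2))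
        (fun h z => hℓ_bdd _ _) hB0 _
    simp only [zero_add, Finset.Icc_self, Finset.sum_singleton] at hn_total hseq ⊢
    have e4 := two_mul_rademacher_le hn_total hB0 hseq e3 (hradB 1 h1κ)
    have e5 : √(1 / (n 1 : ℝ)) = 1 / √(n 1 : ℝ) := by rw [Real.sqrt_div zero_le_one, Real.sqrt_one]
    have e6 : 0 ≤ √2 * B * √(Real.log (1 / δ)) * (1 / √(n 1 : ℝ)) := by positivity
    rw [hsqrt8, e5]
    simp only [zero_add] at e2
    norm_num at e1 e2 e4 e6 ⊢
    linarith
  · have hΔ : ∀ h ∈ H, risk ℓ (D (m + 1) : Measure (Sample X)) h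
        ≤ risk ℓ (D 1 : Measure (Sample X)) h + K * ∑ t ∈ Finset.Icc 1 m, W t :=
      fun h hh => hpath h hh m
    obtain ⟨G, hGm, hGP, hG⟩ := exists_risk_erm_le_empRisk_add hmeas hℓ_bdd hB hΔ (hn 1 h1κ)
      (hn _ hκκ) (hlaw 1 h1κ) (hlaw _ hκκ) hδ0 hδ1
    refine ⟨G, hGm, hGP, fun ω hω => ?_⟩
    have e1 := hG ω hω _ (hERM 1 h1κ ω).1 _ (hERM _ hκκ ω)
    have e2 := htarget _ (hERM _ hκκ ω).1
    have e3 := hradL 1 h1κ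
    have e4 := hradL _ hκκ
    have hS : 1 / √(n 1 : ℝ) + 1 / √(n (m + 1) : ℝ)
        ≤ ∑ t ∈ Finset.range (m + 1), 1 / √(n (t + 1) : ℝ) := by
      obtain ⟨l, rfl⟩ : ∃ l, m = l + 1 := ⟨m - 1, by omega⟩
      rw [Finset.sum_range_succ, Finset.sum_range_succ']
      have : 0 ≤ ∑ t ∈ Finset.range l, 1 / √(n (t + 1 + 1) : ℝ) :=
        Finset.sum_nonneg fun t _ => by positivity
      simp only [zero_add]
      linarith
    have hQ : 1 / √(n (m + 1) : ℝ) ≤ √(∑ t ∈ Finset.Icc 1 (m + 1), 1 / (n t : ℝ)) := by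
      rw [← Real.sqrt_one, ← Real.sqrt_div zero_le_one, Real.sqrt_one]
      exact Real.sqrt_le_sqrt (Finset.single_le_sum (f := fun t => 1 / (n t : ℝ))
        (fun t _ => by positivity) hκκ)
    have e5 := deviation_le_of_two_le (L := L) (B := B) (Λ := √(Real.log (1 / δ)))
      (k := ((m + 1 : ℕ) : ℝ)) (s₁ := 1 / √(n 1 : ℝ)) (s₂ := 1 / √(n (m + 1) : ℝ)) hL hB0 hΛ
      (by exact_mod_cast (by omega : 2 ≤ m + 1)) (by positivity) (by positivity) hS hQ
    rw [hsqrt8]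
    simp only [Nat.add_sub_cancel] at hWsum ⊢
    have e6 : K * ∑ t ∈ Finset.Icc 1 m, W t
        ≤ (1 + 1 / ((m + 1 : ℕ) : ℝ)) * K * ∑ t ∈ Finset.Icc 1 m, W t := by
      have : 0 ≤ 1 / ((m + 1 : ℕ) : ℝ) * (K * ∑ t ∈ Finset.Icc 1 m, W t) := by positivity
      linarith
    rw [div_eq_mul_one_div B] at e3 e4
    linarith
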